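/- Let $\tilde V$ (main channel, output $Y$) and $\tilde W$ (wiretapper's channel, output $Z$) be binary-input memoryless symmetric channels with arbitrary (discrete or continuous) output alphabets, i.e. for each of them a measurable involution of the output alphabet exchanges the output laws given input $0$ and given input $1$; assume that $\tilde W$ is stochastically degraded with respect to $\tilde V$. For $N=2^m$, $m\ge 1$, let $G_N=\left[\begin{smallmatrix}1&0\\1&1\end{smallmatrix}\right]^{\otimes m}$ over $\mathbb F_2$ (so $G_N^{-1}=G_N$). For a binary-input channel $Q$ let $Q_N(\cdot\mid u^{[N]})$ be the law of the output of $N$ independent uses of $Q$ with input $x^{[N]}=u^{[N]}G_N$, and for $i\in[N]$ let $Q_N^{(i)}$ be the $i$-th subchannel $$Q_N^{(i)}(y^{[N]},u^{1:i-1}\mid u^i)=\sum_{u^{i+1:N}}2^{-(N-1)}\,Q_N(y^{[N]}\mid u^{[N]}).$$ Let $\tilde Z(Q)=\sum_y\sqrt{Q(y|0)Q(y|1)}$ be the Bhattacharyya parameter (an integral of densities with respect to a dominating measure if the output is not discrete). For $0<\beta<\tfrac12$ put $$\mathcal G=\{i:\tilde Z(\tilde V_N^{(i)})\le 2^{-N^\beta}\},\qquad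 \mathcal N=\{i:\tilde Z(\tilde W_N^{(i)})\ge 1-2^{-N^\beta}\},$$ $\mathcal A=\mathcal G\cap\mathcal N$, $\mathcal B=\mathcal G\cap\mathcal N^c$, $\mathcal C=\mathcal G^c\cap\mathcal N$, $\mathcal D=\mathcal G^c\cap\mathcal N^c$. Let $U^{[N]}$ be formed by putting message bits $M$ on $\mathcal A$, frozen bits $F$ on $\mathcal C$, and random bits $R$ on $\mathcal B\cup\mathcal D$, where $R$ is uniformly distributed and independent of $(M,F)$ and the joint law of $(M,F)$ is arbitrary (in particular $F$ may be a fixed string), and let $Z^{[N]}$ be the wiretapper's output, with conditional law $\tilde W_N(\cdot\mid u^{[N]})$ given $U^{[N]}=u^{[N]}$. Then for all $0<\beta'<\beta<\tfrac12$ there is an $N_0$, depending only on $\beta$ and $\beta'$, such that for all $N=2^m\ge N_0$, all such channels and all such $(M,F,R)$, the information leakage, measured in bits, satisfies $$I(M;Z^{[N]})\le N\cdot 2^{-N^{\beta'}}.$$ -/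

import Mathlib

open MeasureTheory ProbabilityTheory
open scoped ENNReal

noncomputable section

namespace PolarWiretap

/-! ### Binary-input channels

A binary-input memoryless channel with an arbitrary (discrete or continuous) measurable output
alphabet is a Markov kernel from `ZMod 2`. -/

/-- A binary-input memoryless symmetric (BMS) channel: a Markov kernel for which a measurable
involution of the output alphabet exchanges the two conditional output laws. -/
structure IsBMS {𝓨 : Type*} [MeasurableSpace 𝓨] (W : Kernel (ZMod 2) 𝓨) : Prop where
  markov : IsMarkovKernel W
  symm : ∃ π : 𝓨 → 𝓨, Measurable π ∧ Function.Involutive π ∧ W 1 = (W 0).map π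

/-- `W` is (stochastically) degraded with respect to `V`. -/
def IsDegraded {𝓨 𝓩 : Type*} [MeasurableSpace 𝓨] [MeasurableSpace 𝓩]
    (W : Kernel (ZMod 2) 𝓩) (V : Kernel (ZMod 2) 𝓨) : Prop :=
  ∃ κ : Kernel 𝓨 𝓩, IsMarkovKernel κ ∧ W = κ ∘ₖ V

/-- The Bhattacharyya parameter `∫ √(p(y|0) p(y|1)) dμ(y)`, with the densities taken with respect
to the dominating measure `μ = W(·|0) + W(·|1)` (the integral does not depend on the dominating
measure; for a discrete alphabet it is `∑ y, √(W(y|0) W(y|1))`). -/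
def bhattacharyya {𝓨 : Type*} [MeasurableSpace 𝓨] (W : Kernel (ZMod 2) 𝓨) : ℝ :=
  ∫ y, √(((W 0).rnDeriv (W 0 + W 1) y).toReal * ((W 1).rnDeriv (W 0 + W 1) y).toReal)
    ∂(W 0 + W 1)

/-! ### The polarization transform -/

/-- The generator matrix `G_N = [1 0; 1 1]^{⊗ m}` over `𝔽₂`, of size `N = 2 ^ m`. -/
def polarMatrix : (m : ℕ) → Matrix (Fin (2 ^ m)) (Fin (2 ^ m)) (ZMod 2)
  | 0 => 1
  | m + 1 =>
    Matrix.reindex (finProdFinEquiv.trans (finCongr (pow_succ 2 m).symm))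
      (finProdFinEquiv.trans (finCongr (pow_succ 2 m).symm))
      (Matrix.kronecker (polarMatrix m) !![1, 0; 1, 1])

/-- `G_N` is an involution over `𝔽₂`, so that `u = x G_N` and `x = u G_N` are equivalent. -/
theorem polarMatrix_mul_self (m : ℕ) : polarMatrix m * polarMatrix m = 1 := by
  induction m with
  | zero => simp [polarMatrix]
  | succ m ih =>
    have h : (!![1, 0; 1, 1] * !![1, 0; 1, 1] : Matrix (Fin 2) (Fin 2) (ZMod 2)) = 1 := by
      decide
    simp only [polarMatrix, Matrix.reindex_apply, Matrix.submatrix_mul_equiv]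
    rw [Matrix.kronecker, ← Matrix.mul_kronecker_mul, ih, h, Matrix.one_kronecker_one,
      Matrix.submatrix_one_equiv]

/-- The combined channel `W_N` from `u^{[N]}` to `y^{[N]}`, for `N = 2 ^ m`: the word
`x = u G_N` is sent through `N` independent uses of `W`. -/
def combinedChannel {𝓨 : Type*} [MeasurableSpace 𝓨] (W : Kernel (ZMod 2) 𝓨) (m : ℕ) :
    Kernel (Fin (2 ^ m) → ZMod 2) (Fin (2 ^ m) → 𝓨) :=
  Kernel.ofFunOfCountable fun u =>
    Measure.pi fun i => W (Matrix.vecMul u (polarMatrix m) i)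

instance {𝓨 : Type*} [MeasurableSpace 𝓨] (W : Kernel (ZMod 2) 𝓨) [IsMarkovKernel W] (m : ℕ) :
    IsMarkovKernel (combinedChannel W m) :=
  ⟨fun u => inferInstanceAs (IsProbabilityMeasure
    (Measure.pi fun i => W (Matrix.vecMul u (polarMatrix m) i)))⟩

/-- The `i`-th subchannel `W_N^{(i)}`, from `u^i` to `(y^{[N]}, u^{1:i-1})`, whose transition
probabilities are `∑_{u^{i+1:N}} 2^{-(N-1)} W_N(y^{[N]} | u^{[N]})`. -/
def subchannel {𝓨 : Type*} [MeasurableSpace 𝓨] (W : Kernel (ZMod 2) 𝓨) (m : ℕ)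
    (i : Fin (2 ^ m)) :
    Kernel (ZMod 2) ((Fin (2 ^ m) → 𝓨) × ({j : Fin (2 ^ m) // j < i} → ZMod 2)) :=
  Kernel.ofFunOfCountable fun b =>
    ∑ u : Fin (2 ^ m) → ZMod 2 with u i = b,
      ((2 : ℝ≥0∞) ^ (2 ^ m - 1))⁻¹ •
        (combinedChannel W m u).prod (Measure.dirac fun j : {j : Fin (2 ^ m) // j < i} => u j)

/-! ### The partition of the index set -/

/-- The reliability-good indices `𝒢(V) = {i : Z(V_N^{(i)}) ≤ 2^{-N^β}}`, `N = 2 ^ m`. -/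
def goodSet {𝓨 : Type*} [MeasurableSpace 𝓨] (V : Kernel (ZMod 2) 𝓨) (β : ℝ) (m : ℕ) :
    Set (Fin (2 ^ m)) :=
  {i | bhattacharyya (subchannel V m i) ≤ (2 : ℝ) ^ (-(((2 : ℝ) ^ m) ^ β))}

/-- The information-poor indices `𝒩(W) = {i : Z(W_N^{(i)}) ≥ 1 - 2^{-N^β}}`, `N = 2 ^ m`. -/
def poorSet {𝓩 : Type*} [MeasurableSpace 𝓩] (W : Kernel (ZMod 2) 𝓩) (β : ℝ) (m : ℕ) :
    Set (Fin (2 ^ m)) :=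
  {i | 1 - (2 : ℝ) ^ (-(((2 : ℝ) ^ m) ^ β)) ≤ bhattacharyya (subchannel W m i)}

section Partition

variable {𝓨 𝓩 : Type*} [MeasurableSpace 𝓨] [MeasurableSpace 𝓩]
  (V : Kernel (ZMod 2) 𝓨) (W : Kernel (ZMod 2) 𝓩) (β : ℝ) (m : ℕ)

/-- `𝒜 = 𝒢(V) ∩ 𝒩(W)`. -/
def setA : Set (Fin (2 ^ m)) := goodSet V β m ∩ poorSet W β m

/-- `ℬ = 𝒢(V) ∩ 𝒩(W)ᶜ`. -/
def setB : Set (Fin (2 ^ m)) := goodSet V β m ∩ (poorSet W β m)ᶜ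

/-- `𝒞 = 𝒢(V)ᶜ ∩ 𝒩(W)`. -/
def setC : Set (Fin (2 ^ m)) := (goodSet V β m)ᶜ ∩ poorSet W β m

/-- `𝒟 = 𝒢(V)ᶜ ∩ 𝒩(W)ᶜ`. -/
def setD : Set (Fin (2 ^ m)) := (goodSet V β m)ᶜ ∩ (poorSet W β m)ᶜ

end Partition

/-! ### The coding scheme and the leakage -/

/-- The mutual information `I(X; Y)`, in bits: the Kullback-Leibler divergence of the joint law
from the product of the marginal laws. -/
def mutualInfo {Ω α β : Type*} [MeasurableSpace Ω] [MeasurableSpace α] [MeasurableSpace β]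
    (P : Measure Ω) (X : Ω → α) (Y : Ω → β) : ℝ≥0∞ :=
  InformationTheory.klDiv (P.map fun ω => (X ω, Y ω)) ((P.map X).prod (P.map Y)) /
    ENNReal.ofReal (Real.log 2)

/-- The assignment `𝒜 ← M`, `ℬ ← R`, `𝒞 ← F`, `𝒟 ← R'`, with wiretapper's output `Z`.
The random bits `(R, R')` are uniform and independent of `(M, F)`; the joint law of the message
bits `M` and the frozen bits `F` is arbitrary (in particular `F` may be deterministic). The
assembled word `U` is sent through the combined channel of `N = 2 ^ m` uses of `W`. -/
structure IsWiretapScheme {Ω 𝓩 : Type*} [MeasurableSpace Ω] [MeasurableSpace 𝓩]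
    (P : Measure Ω) (W : Kernel (ZMod 2) 𝓩) {m : ℕ} (A B C D : Set (Fin (2 ^ m)))
    (M : Ω → A → ZMod 2) (R : Ω → B → ZMod 2) (F : Ω → C → ZMod 2) (R' : Ω → D → ZMod 2)
    (U : Ω → Fin (2 ^ m) → ZMod 2) (Z : Ω → Fin (2 ^ m) → 𝓩) : Prop where
  measurable_M : Measurable M
  measurable_R : Measurable R
  measurable_F : Measurable F
  measurable_R' : Measurable R'
  measurable_Z : Measurable Z
  random_uniform : HasLaw (fun ω => (R ω, R' ω)) (uniformOn Set.univ) P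
  random_indep : IndepFun (fun ω => (M ω, F ω)) (fun ω => (R ω, R' ω)) P
  assign_A : ∀ ω (i : A), U ω i = M ω i
  assign_B : ∀ ω (i : B), U ω i = R ω i
  assign_C : ∀ ω (i : C), U ω i = F ω i
  assign_D : ∀ ω (i : D), U ω i = R' ω i
  channel : HasCondDistrib Z U (combinedChannel W m) P

end PolarWiretap

end

noncomputable section

namespace PolarWiretap

/-! ### Averaging over the binary cube -/

section CubeAverage

variable {ι : Type*} [Fintype ι] [DecidableEq ι]

/-! Write `S` for the index set `𝒩 = 𝒜 ∪ 𝒞`. The random bits fill exactly the complement of `S` and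
are uniform and independent of the rest, so the law of `U` depends only on `U_S`, and given `U_S`
the output `Z` has density `cubeAvg S` of the word density. The message is a function of `U_S`, so
`I(M;Z)` is at most the average over `U_S` of the divergence of this conditional output law from any
fixed reference law (`sum_klIntegrand_le`). The reference chosen is the output law `cubeAvg ∅` of a
uniform input.

The law of `U_S` itself is arbitrary, and symmetry of the channel deals with this: translating the
input permutes outputs by a measure preserving map, so the divergence is the same for every value of
`U_S` (`integral_klIntegrand_cubeAvg_eq`). It therefore equals its average over uniform inputs,
which is the mutual information between `U_S` and `Z` for uniform `U`.

For uniform `U`, the chain rule together with enlarging each conditioning set to the whole past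
(`sum_mul_log_cubeAvg_le_sum`) bounds this by the sum over `i ∈ S` of the information through the
`i`-th subchannel. Each term is at most `2 * (1 - Z(W_N^{(i)}))` nats, through a chi-square and
Hellinger comparison (`sum_mul_log_cubeAvg_insert_le`). Indices in `𝒩` contribute at most `2 *
2^{-N^β}` each. Conversion to bits costs at most another factor 2, and the resulting factor 4 is
absorbed by passing from `β` to `β'`. -/

/-- The average of `g` over all words that agree with `u` on `T`. -/
def cubeAvg (T : Finset ι) (g : (ι → ZMod 2) → ℝ) (u : ι → ZMod 2) : ℝ :=
  (2 ^ Fintype.card ι : ℝ)⁻¹ * ∑ w : ι → ZMod 2, g (T.piecewise u w)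

/-- `h` depends only on the coordinates in `T`. -/
def DependsOnlyOn (T : Finset ι) (h : (ι → ZMod 2) → ℝ) : Prop :=
  ∀ u w, h (T.piecewise u w) = h u

lemma sum_cube_const (c : ℝ) : ∑ _w : ι → ZMod 2, c = 2 ^ Fintype.card ι * c := by
  simp [Finset.card_univ, ZMod.card]

/-- Exchanging the coordinates outside `T` of two words. -/
def exchangeEquiv (T : Finset ι) :
    (ι → ZMod 2) × (ι → ZMod 2) ≃ (ι → ZMod 2) × (ι → ZMod 2) where
  toFun p := (T.piecewise p.1 p.2, T.piecewise p.2 p.1)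
  invFun p := (T.piecewise p.1 p.2, T.piecewise p.2 p.1)
  left_inv p := by
    ext j <;> by_cases hj : j ∈ T <;> simp [hj]
  right_inv p := by
    ext j <;> by_cases hj : j ∈ T <;> simp [hj]

/-- Swapping the coordinates outside `T` is a bijection on pairs of words, so the merged word is
equidistributed when both words run over the cube. -/
lemma sum_sum_piecewise (T : Finset ι) (φ : (ι → ZMod 2) → ℝ) :
    ∑ u, ∑ w, φ (T.piecewise u w) = 2 ^ Fintype.card ι * ∑ u, φ u := by
  have h := Equiv.sum_comp (exchangeEquiv T) (fun p => φ p.1)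
  rw [Fintype.sum_prod_type, Fintype.sum_prod_type] at h
  simp only [exchangeEquiv, Equiv.coe_fn_mk, sum_cube_const] at h
  rw [h]
  rw [Finset.mul_sum]

/-- `cubeAvg T` is the conditional expectation given the coordinates in `T` under the uniform law;
this is its defining property, and `cubeAvg_cubeAvg` is the corresponding tower rule. -/
lemma sum_cubeAvg_mul (T : Finset ι) (g h : (ι → ZMod 2) → ℝ) (hh : DependsOnlyOn T h) :
    ∑ u, cubeAvg T g u * h u = ∑ u, g u * h u := by
  have h2 : (2 ^ Fintype.card ι : ℝ) ≠ 0 := by positivity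
  have := sum_sum_piecewise T (fun u => g u * h u)
  simp only [hh _ _] at this
  simp only [cubeAvg, mul_assoc, Finset.sum_mul]
  rw [← Finset.mul_sum, this, inv_mul_cancel_left₀ h2]

lemma sum_cubeAvg (T : Finset ι) (g : (ι → ZMod 2) → ℝ) :
    ∑ u, cubeAvg T g u = ∑ u, g u := by
  simpa using sum_cubeAvg_mul T g (fun _ => 1) (fun _ _ => rfl)

lemma cubeAvg_cubeAvg (S T : Finset ι) (g : (ι → ZMod 2) → ℝ) (u : ι → ZMod 2) :
    cubeAvg S (cubeAvg T g) u = cubeAvg (S ∩ T) g u := by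
  have h2 : (2 ^ Fintype.card ι : ℝ) ≠ 0 := by positivity
  have := sum_sum_piecewise T (fun w => g ((S ∩ T).piecewise u w))
  have key : ∀ w v : ι → ZMod 2, T.piecewise (S.piecewise u w) v =
      (S ∩ T).piecewise u (T.piecewise w v) := by
    intro w v
    ext j
    by_cases h1 : j ∈ T <;> by_cases h2 : j ∈ S <;> simp [h1, h2]
  simp only [cubeAvg, key]
  rw [← Finset.mul_sum, this, inv_mul_cancel_left₀ h2]

lemma dependsOnlyOn_cubeAvg {S T : Finset ι} (hST : S ⊆ T) (g : (ι → ZMod 2) → ℝ) :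
    DependsOnlyOn T (cubeAvg S g) := by
  intro u w
  have key : ∀ v : ι → ZMod 2, S.piecewise (T.piecewise u w) v = S.piecewise u v := by
    intro v
    ext j
    by_cases h1 : j ∈ S
    · simp [h1, hST h1]
    · simp [h1]
  simp only [cubeAvg, key]

lemma cubeAvg_nonneg (T : Finset ι) {g : (ι → ZMod 2) → ℝ} (hg : ∀ u, 0 ≤ g u)
    (u : ι → ZMod 2) : 0 ≤ cubeAvg T g u :=
  mul_nonneg (by positivity) (Finset.sum_nonneg fun _ _ => hg _)

lemma le_cubeAvg (T : Finset ι) {g : (ι → ZMod 2) → ℝ} (hg : ∀ u, 0 ≤ g u)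
    (u : ι → ZMod 2) : g u ≤ 2 ^ Fintype.card ι * cubeAvg T g u := by
  have h2 : (2 ^ Fintype.card ι : ℝ) ≠ 0 := by positivity
  rw [cubeAvg, mul_inv_cancel_left₀ h2]
  have := Finset.single_le_sum (f := fun w => g (T.piecewise u w)) (fun _ _ => hg _)
    (Finset.mem_univ u)
  simpa only [Finset.piecewise_same] using this

lemma cubeAvg_pos (T : Finset ι) {g : (ι → ZMod 2) → ℝ} (hg : ∀ u, 0 ≤ g u)
    {u : ι → ZMod 2} (hu : 0 < g u) : 0 < cubeAvg T g u := by
  have := le_cubeAvg T hg u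
  by_contra! h
  have : (2 : ℝ) ^ Fintype.card ι * cubeAvg T g u ≤ 0 :=
    mul_nonpos_of_nonneg_of_nonpos (by positivity) h
  linarith

lemma cubeAvg_empty (g : (ι → ZMod 2) → ℝ) (u : ι → ZMod 2) :
    cubeAvg ∅ g u = (2 ^ Fintype.card ι : ℝ)⁻¹ * ∑ w, g w := by
  simp [cubeAvg]

/-- Crude domination by the uniform-input density: it supplies absolute continuity and integrability
of the divergence integrands. -/
lemma cubeAvg_le_cubeAvg_empty (T : Finset ι) {g : (ι → ZMod 2) → ℝ} (hg : ∀ u, 0 ≤ g u)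
    (u v : ι → ZMod 2) : cubeAvg T g u ≤ 2 ^ Fintype.card ι * cubeAvg ∅ g v := by
  have h2 : (2 ^ Fintype.card ι : ℝ) ≠ 0 := by positivity
  rw [cubeAvg_empty, mul_inv_cancel_left₀ h2, ← sum_cubeAvg T g]
  exact Finset.single_le_sum (f := cubeAvg T g) (fun _ _ => cubeAvg_nonneg T hg _)
    (Finset.mem_univ u)

lemma cubeAvg_add_right (T : Finset ι) (g : (ι → ZMod 2) → ℝ) (u a : ι → ZMod 2) :
    cubeAvg T g (u + a) = cubeAvg T (fun v => g (v + a)) u := by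
  unfold cubeAvg
  congr 1
  rw [← Equiv.sum_comp (Equiv.addRight a)]
  refine Finset.sum_congr rfl fun w _ => congrArg g ?_
  ext j
  by_cases h : j ∈ T <;> simp [h]

/-- With bit `i` uniform, averaging over it is the mean of its two conditional values. -/
lemma cubeAvg_insert_add_flip {T : Finset ι} {i : ι} (hi : i ∉ T) (g : (ι → ZMod 2) → ℝ)
    (u : ι → ZMod 2) :
    cubeAvg (insert i T) g u + cubeAvg (insert i T) g (u + Pi.single i 1) =
      2 * cubeAvg T g u := by
  have hsum : ∑ w : ι → ZMod 2, g (T.piecewise u w) =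
      ∑ w : ι → ZMod 2, g (T.piecewise u (w + Pi.single i 1)) :=
    (Equiv.sum_comp (Equiv.addRight (Pi.single i 1 : ι → ZMod 2))
      (fun w => g (T.piecewise u w))).symm
  have key : ∑ w : ι → ZMod 2, g ((insert i T).piecewise u w) +
      ∑ w : ι → ZMod 2, g ((insert i T).piecewise (u + Pi.single i 1) w) =
      ∑ w : ι → ZMod 2, g (T.piecewise u w) +
        ∑ w : ι → ZMod 2, g (T.piecewise u (w + Pi.single i 1)) := by
    rw [← Finset.sum_add_distrib, ← Finset.sum_add_distrib]
    refine Finset.sum_congr rfl fun w _ => ?_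
    -- Exactly one of `w` and `w` flipped at `i` agrees with `u` at `i`, so the two pairs of words
    -- coincide, either in order or swapped.
    have hw : u i = w i ∨ u i = w i + 1 := by
      generalize u i = x
      generalize w i = y
      revert x y
      decide
    have h11 : (1 : ZMod 2) + 1 = 0 := by decide
    rcases hw with hw | hw
    · congr 2 <;>
      · ext j
        by_cases hj : j = i
        · subst hj; simp [hi, hw]
        · by_cases hT : j ∈ T <;> simp [hj, hT]
    · rw [add_comm]
      congr 2 <;>
      · ext j
        by_cases hj : j = i
        · subst hj; simp [hi, hw, add_assoc, h11]
        · by_cases hT : j ∈ T <;> simp [hj, hT]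
  rw [← hsum] at key
  simp only [cubeAvg]
  rw [← mul_add, key]
  ring

/-- Conditioning on more coordinates reduces the entropy of a further coordinate. -/
lemma sum_mul_log_cubeAvg_mono {S T : Finset ι} (hST : S ⊆ T) {i : ι} (hi : i ∉ T)
    {g : (ι → ZMod 2) → ℝ} (hg : ∀ u, 0 ≤ g u) :
    ∑ u, g u * (Real.log (cubeAvg (insert i S) g u) - Real.log (cubeAvg S g u)) ≤
      ∑ u, g u * (Real.log (cubeAvg (insert i T) g u) - Real.log (cubeAvg T g u)) := by
  set a := cubeAvg (insert i S) g
  set b := cubeAvg S g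
  set c := cubeAvg (insert i T) g
  set d := cubeAvg T g
  have ha : ∀ u, 0 ≤ a u := cubeAvg_nonneg _ hg
  have hb : ∀ u, 0 ≤ b u := cubeAvg_nonneg _ hg
  have hc : ∀ u, 0 ≤ c u := cubeAvg_nonneg _ hg
  have hd : ∀ u, 0 ≤ d u := cubeAvg_nonneg _ hg
  -- Apply `log x ≤ x - 1` to `x = a d / (b c)`. It remains to see that the `g`-weighted sum of `x`
  -- is at most that of `1`, which is nonnegativity of a conditional mutual information.
  have hterm : ∀ u, g u * (Real.log (a u) - Real.log (b u)) -
      g u * (Real.log (c u) - Real.log (d u)) ≤ g u * (a u / b u * d u / c u) - g u := by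
    intro u
    rcases (hg u).eq_or_lt with h0 | hpos
    · simp [← h0]
    have pa : 0 < a u := cubeAvg_pos _ hg hpos
    have pb : 0 < b u := cubeAvg_pos _ hg hpos
    have pc : 0 < c u := cubeAvg_pos _ hg hpos
    have pd : 0 < d u := cubeAvg_pos _ hg hpos
    have h1 := Real.log_le_sub_one_of_pos (x := a u / b u * d u / c u) (by positivity)
    rw [Real.log_div (by positivity) pc.ne', Real.log_mul (by positivity) pd.ne',
      Real.log_div pa.ne' pb.ne'] at h1
    have := mul_le_mul_of_nonneg_left h1 hpos.le
    linarith
  have hdep : DependsOnlyOn (insert i T) (fun u => a u / b u * d u / c u) := by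
    have h1 := dependsOnlyOn_cubeAvg (Finset.insert_subset_insert i hST) g
    have h2 := dependsOnlyOn_cubeAvg (hST.trans (Finset.subset_insert i T)) g
    have h3 := dependsOnlyOn_cubeAvg (Finset.Subset.refl (insert i T)) g
    have h4 := dependsOnlyOn_cubeAvg (Finset.subset_insert i T) g
    intro u w
    simp only [a, b, c, d, h1 u w, h2 u w, h3 u w, h4 u w]
  have hdep' : DependsOnlyOn (insert i S) (fun u => a u / b u) := by
    have h1 := dependsOnlyOn_cubeAvg (Finset.Subset.refl (insert i S)) g
    have h2 := dependsOnlyOn_cubeAvg (Finset.subset_insert i S) g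
    intro u w
    simp only [a, b, h1 u w, h2 u w]
  have hinter : insert i S ∩ T = S := by
    ext j
    simp only [Finset.mem_inter, Finset.mem_insert]
    constructor
    · rintro ⟨rfl | h, h'⟩
      · exact absurd h' hi
      · exact h
    · exact fun h => ⟨Or.inr h, hST h⟩
  -- Average first over the coordinates outside `insert i T`, which cancels `c`, then outside
  -- `insert i S`, which turns `d` into `b`. Only inequalities hold, since a vanishing denominator
  -- makes the quotient 0.
  have hsum : ∑ u, g u * (a u / b u * d u / c u) ≤ ∑ u, g u := by
    calc ∑ u, g u * (a u / b u * d u / c u) = ∑ u, c u * (a u / b u * d u / c u) :=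
          (sum_cubeAvg_mul _ g _ hdep).symm
      _ ≤ ∑ u, d u * (a u / b u) := by
          refine Finset.sum_le_sum fun u _ => ?_
          rcases (hc u).eq_or_lt with h0 | hpos
          · rw [← h0]; simpa using mul_nonneg (hd u) (div_nonneg (ha u) (hb u))
          · rw [mul_div_cancel₀ _ hpos.ne', mul_comm]
      _ = ∑ u, cubeAvg (insert i S) d u * (a u / b u) := (sum_cubeAvg_mul _ d _ hdep').symm
      _ = ∑ u, b u * (a u / b u) := by
          refine Finset.sum_congr rfl fun u _ => ?_
          rw [cubeAvg_cubeAvg, hinter]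
      _ ≤ ∑ u, a u := by
          refine Finset.sum_le_sum fun u _ => ?_
          rcases (hb u).eq_or_lt with h0 | hpos
          · rw [← h0]; simpa using ha u
          · rw [mul_div_cancel₀ _ hpos.ne']
      _ = ∑ u, g u := sum_cubeAvg _ g
  have := Finset.sum_le_sum fun u (_ : u ∈ Finset.univ) => hterm u
  rw [Finset.sum_sub_distrib, Finset.sum_sub_distrib] at this
  linarith

/-- With `x = √a` and `y = √b`, this is `(x + y)² ≤ 2(x² + y²)` multiplied by `(x - y)²`: chi-square
against the midpoint is controlled by Hellinger distance. -/
lemma sq_sub_div_add_le {a b : ℝ} (ha : 0 ≤ a) (hb : 0 ≤ b) :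
    (a - b) ^ 2 / (a + b) ≤ 2 * (a + b - 2 * √(a * b)) := by
  rw [Real.sqrt_mul ha]
  obtain ⟨x, hx, rfl⟩ : ∃ x, 0 ≤ x ∧ a = x ^ 2 := ⟨√a, Real.sqrt_nonneg a, (Real.sq_sqrt ha).symm⟩
  obtain ⟨y, hy, rfl⟩ : ∃ y, 0 ≤ y ∧ b = y ^ 2 := ⟨√b, Real.sqrt_nonneg b, (Real.sq_sqrt hb).symm⟩
  rw [Real.sqrt_sq hx, Real.sqrt_sq hy]
  rcases (add_nonneg ha hb).eq_or_lt with h0 | hpos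
  · rw [← h0, div_zero]
    nlinarith [sq_nonneg (x - y)]
  · rw [div_le_iff₀ hpos]
    nlinarith [mul_nonneg (sq_nonneg (x - y)) (sq_nonneg (x - y))]

/-- The information carried by a coordinate, bounded by the squared Hellinger distance of the two
conditional weights. -/
lemma sum_mul_log_cubeAvg_insert_le {T : Finset ι} {i : ι} (hi : i ∉ T)
    {g : (ι → ZMod 2) → ℝ} (hg : ∀ u, 0 ≤ g u) :
    ∑ u, g u * (Real.log (cubeAvg (insert i T) g u) - Real.log (cubeAvg T g u)) ≤
      2 * ∑ u, (g u -
        √(cubeAvg (insert i T) g u * cubeAvg (insert i T) g (u + Pi.single i 1))) := by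
  set a := cubeAvg (insert i T) g
  set e := cubeAvg T g
  set s : ι → ZMod 2 := Pi.single i 1
  have ha : ∀ u, 0 ≤ a u := cubeAvg_nonneg _ hg
  have he : ∀ u, 0 ≤ e u := cubeAvg_nonneg _ hg
  have hae : ∀ u, a u + a (u + s) = 2 * e u := cubeAvg_insert_add_flip hi g
  have hss : s + s = 0 := by
    ext j
    have : ∀ x : ZMod 2, x + x = 0 := by decide
    simp [this]
  have hes : ∀ u, e (u + s) = e u := by
    intro u
    have h1 := hae u
    have h2 := hae (u + s)
    rw [add_assoc, hss, add_zero] at h2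
    linarith
  have hterm : ∀ u, g u * (Real.log (a u) - Real.log (e u)) ≤ g u * (a u / e u) - g u := by
    intro u
    rcases (hg u).eq_or_lt with h0 | hpos
    · simp [← h0]
    have pa : 0 < a u := cubeAvg_pos _ hg hpos
    have pe : 0 < e u := cubeAvg_pos _ hg hpos
    have h1 := Real.log_le_sub_one_of_pos (x := a u / e u) (by positivity)
    rw [Real.log_div pa.ne' pe.ne'] at h1
    have := mul_le_mul_of_nonneg_left h1 hpos.le
    linarith
  have hdep : DependsOnlyOn (insert i T) (fun u => a u / e u) := by
    have h1 := dependsOnlyOn_cubeAvg (Finset.Subset.refl (insert i T)) g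
    have h2 := dependsOnlyOn_cubeAvg (Finset.subset_insert i T) g
    intro u w
    simp only [a, e, h1 u w, h2 u w]
  have hflip : ∀ φ : (ι → ZMod 2) → ℝ, ∑ u, φ (u + s) = ∑ u, φ u := fun φ =>
    Equiv.sum_comp (Equiv.addRight s) φ
  have hsa : ∑ u, a u = ∑ u, g u := sum_cubeAvg _ g
  -- `log x ≤ x - 1` has replaced the divergence by a chi-square sum. Since `e` is the midpoint of
  -- the two values of `a`, the terms at `u` and at its flip add up to `(a - a')² / (a + a')`.
  have hpt : ∀ u, (a u * (a u / e u) - a u) + (a (u + s) * (a (u + s) / e (u + s)) - a (u + s)) ≤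
      2 * (a u + a (u + s) - 2 * √(a u * a (u + s))) := by
    intro u
    refine le_trans (le_of_eq ?_) (sq_sub_div_add_le (ha u) (ha (u + s)))
    rw [hes, hae]
    have h1 := hae u
    rcases (he u).eq_or_lt with h0 | hpos
    · have h3 : a u = 0 := by linarith [ha u, ha (u + s)]
      have h4 : a (u + s) = 0 := by linarith [ha u, ha (u + s)]
      rw [h3, h4]
      simp
    · have h3 : a (u + s) = 2 * e u - a u := by linarith
      rw [h3]
      field_simp
      ring
  have hs1 : ∑ u, (a u * (a u / e u) - a u) ≤ 2 * ∑ u, (g u - √(a u * a (u + s))) := by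
    have h := Finset.sum_le_sum fun u (_ : u ∈ Finset.univ) => hpt u
    rw [Finset.sum_add_distrib, hflip (fun u => a u * (a u / e u) - a u), ← Finset.mul_sum,
      Finset.sum_sub_distrib (f := fun u => a u + a (u + s)), Finset.sum_add_distrib, hflip a,
      ← Finset.mul_sum, hsa] at h
    rw [Finset.sum_sub_distrib (f := g)]
    linarith
  calc ∑ u, g u * (Real.log (a u) - Real.log (e u)) ≤ ∑ u, (g u * (a u / e u) - g u) :=
        Finset.sum_le_sum fun u _ => hterm u
    _ = ∑ u, (a u * (a u / e u) - a u) := by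
        rw [Finset.sum_sub_distrib, Finset.sum_sub_distrib, hsa,
          sum_cubeAvg_mul (insert i T) g _ hdep]
    _ ≤ _ := hs1

end CubeAverage

/-- Chain rule: the information about the coordinates in `S` is at most the sum of the
successive single-coordinate bounds. -/
lemma sum_mul_log_cubeAvg_le_sum {n : ℕ} (S : Finset (Fin n)) {g : (Fin n → ZMod 2) → ℝ}
    (hg : ∀ u, 0 ≤ g u) :
    ∑ u, g u * (Real.log (cubeAvg S g u) - Real.log (cubeAvg ∅ g u)) ≤
      ∑ i ∈ S, 2 * ∑ u, (g u - √(cubeAvg (insert i (Finset.Iio i)) g u *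
        cubeAvg (insert i (Finset.Iio i)) g (u + Pi.single i 1))) := by
  -- Indices are added in increasing order, so the earlier ones lie in the past `Finset.Iio i` and
  -- the conditioning can be enlarged to it.
  induction S using Finset.induction_on_max with
  | empty => simp
  | insert i S hS ih =>
    have hi : i ∉ S := fun h => lt_irrefl _ (hS i h)
    rw [Finset.sum_insert hi]
    have hsub : S ⊆ Finset.Iio i := fun j hj => Finset.mem_Iio.2 (hS j hj)
    have hnot : i ∉ Finset.Iio i := by simp
    have h1 := (sum_mul_log_cubeAvg_mono hsub hnot hg).trans
      (sum_mul_log_cubeAvg_insert_le hnot hg)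
    have h2 := add_le_add h1 ih
    refine le_trans (le_of_eq ?_) h2
    rw [← Finset.sum_add_distrib]
    refine Finset.sum_congr rfl fun u _ => ?_
    ring

/-! ### Densities with respect to a dominating measure -/

section Density

variable {α : Type*} [MeasurableSpace α] {μ : Measure α} {p q : α → ℝ}

lemma withDensity_ofReal_div (hp : Measurable p) (hq : Measurable q) (hq0 : ∀ x, 0 ≤ q x)
    (hpq : ∀ x, q x = 0 → p x = 0) :
    (μ.withDensity fun x => ENNReal.ofReal (q x)).withDensity
      (fun x => ENNReal.ofReal (p x / q x)) = μ.withDensity fun x => ENNReal.ofReal (p x) := by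
  rw [← withDensity_mul _ (by fun_prop) (by fun_prop)]
  congr 1
  ext x
  rw [Pi.mul_apply, ← ENNReal.ofReal_mul (hq0 x)]
  by_cases h : q x = 0
  · simp [h, hpq x h]
  · rw [mul_div_cancel₀ _ h]

lemma rnDeriv_withDensity_ofReal [SigmaFinite μ] (hp : Measurable p) (hq : Measurable q)
    (hq0 : ∀ x, 0 ≤ q x) (hpq : ∀ x, q x = 0 → p x = 0) :
    (μ.withDensity fun x => ENNReal.ofReal (p x)).rnDeriv
        (μ.withDensity fun x => ENNReal.ofReal (q x))
      =ᵐ[μ.withDensity fun x => ENNReal.ofReal (q x)] fun x => ENNReal.ofReal (p x / q x) := by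
  have : SigmaFinite (μ.withDensity fun x => ENNReal.ofReal (q x)) :=
    SigmaFinite.withDensity_ofReal q
  rw [← withDensity_ofReal_div hp hq hq0 hpq]
  exact Measure.rnDeriv_withDensity _ (by fun_prop)

/-- Independence of the dominating measure: the geometric mean of the densities is homogeneous of
degree one, so the factor `f 0 + f 1` cancels. -/
lemma bhattacharyya_eq_integral [SigmaFinite μ] {W : Kernel (ZMod 2) α} {f : ZMod 2 → α → ℝ}
    (hf : ∀ b, Measurable (f b)) (hf0 : ∀ b x, 0 ≤ f b x)
    (hW : ∀ b, W b = μ.withDensity fun x => ENNReal.ofReal (f b x)) :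
    bhattacharyya W = ∫ x, √(f 0 x * f 1 x) ∂μ := by
  have hsum : W 0 + W 1 = μ.withDensity fun x => ENNReal.ofReal (f 0 x + f 1 x) := by
    rw [hW, hW, ← withDensity_add_left (by have := hf 0; fun_prop)]
    congr 1
    ext x
    rw [Pi.add_apply, ENNReal.ofReal_add (hf0 0 x) (hf0 1 x)]
  have hm : Measurable fun x => f 0 x + f 1 x := (hf 0).add (hf 1)
  have hnn : ∀ x, 0 ≤ f 0 x + f 1 x := fun x => add_nonneg (hf0 0 x) (hf0 1 x)
  have h0 := rnDeriv_withDensity_ofReal (μ := μ) (hf 0) hm hnn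
    (fun x hx => by linarith [hf0 0 x, hf0 1 x])
  have h1 := rnDeriv_withDensity_ofReal (μ := μ) (hf 1) hm hnn
    (fun x hx => by linarith [hf0 0 x, hf0 1 x])
  rw [← hW, ← hsum] at h0 h1
  unfold bhattacharyya
  rw [integral_congr_ae (g := fun x => √((f 0 x / (f 0 x + f 1 x)) * (f 1 x / (f 0 x + f 1 x))))]
  · rw [hsum, integral_withDensity_eq_integral_toReal_smul (by fun_prop) (by simp)]
    refine integral_congr_ae (.of_forall fun x => ?_)
    simp only [smul_eq_mul]
    rw [ENNReal.toReal_ofReal (hnn x), div_mul_div_comm, Real.sqrt_div' _ (mul_self_nonneg _),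
      Real.sqrt_mul_self (hnn x)]
    rcases (hnn x).eq_or_lt with h | h
    · have : f 0 x = 0 := by linarith [hf0 0 x, hf0 1 x]
      simp [this]
    · rw [mul_div_cancel₀ _ h.ne']
  · filter_upwards [h0, h1] with x hx0 hx1
    rw [hx0, hx1, ENNReal.toReal_ofReal (div_nonneg (hf0 0 x) (hnn x)),
      ENNReal.toReal_ofReal (div_nonneg (hf0 1 x) (hnn x))]

/-- The integrand of the Kullback-Leibler divergence of two laws with densities `p` and `q`. -/
def klIntegrand (p q : ℝ) : ℝ := q * InformationTheory.klFun (p / q)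

lemma klIntegrand_nonneg {p q : ℝ} (hp : 0 ≤ p) (hq : 0 ≤ q) : 0 ≤ klIntegrand p q :=
  mul_nonneg hq (InformationTheory.klFun_nonneg (div_nonneg hp hq))

/-- The term `q - p` makes the integrand pointwise nonnegative; it drops out after summation
whenever both sides have equal mass. -/
lemma klIntegrand_eq {p q : ℝ} (hpq : q = 0 → p = 0) :
    klIntegrand p q = p * (Real.log p - Real.log q) + q - p := by
  by_cases hq : q = 0
  · simp [klIntegrand, hq, hpq hq]
  by_cases hp : p = 0
  · simp [klIntegrand, hp, InformationTheory.klFun]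
  rw [klIntegrand, InformationTheory.klFun, Real.log_div hp hq]
  field_simp

/-- From `log r ≤ r` one gets `r log r + 1 - r ≤ r² + 1` for the ratio `r = p / q ≤ C`. -/
lemma klIntegrand_le {p q C : ℝ} (hp : 0 ≤ p) (hq : 0 ≤ q) (hC : 0 ≤ C) (hpq : p ≤ C * q) :
    klIntegrand p q ≤ (C ^ 2 + 1) * q := by
  rcases hq.eq_or_lt with h | h
  · simp [klIntegrand, ← h]
  have hr : p / q ≤ C := (div_le_iff₀ h).2 hpq
  have hr0 : 0 ≤ p / q := div_nonneg hp hq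
  rw [klIntegrand, mul_comm]
  refine mul_le_mul_of_nonneg_right ?_ hq
  have hlog : p / q * Real.log (p / q) ≤ p / q * (p / q) := by
    refine mul_le_mul_of_nonneg_left ?_ hr0
    linarith [Real.log_le_self hr0]
  rw [InformationTheory.klFun]
  nlinarith

lemma measurable_klIntegrand (hp : Measurable p) (hq : Measurable q) :
    Measurable fun x => klIntegrand (p x) (q x) :=
  hq.mul (InformationTheory.measurable_klFun.comp (hp.div hq))

lemma klDiv_withDensity_ofReal [SigmaFinite μ] (hp : Measurable p) (hq : Measurable q)
    (hp0 : ∀ x, 0 ≤ p x) (hq0 : ∀ x, 0 ≤ q x) (hpq : ∀ x, q x = 0 → p x = 0)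
    [IsFiniteMeasure (μ.withDensity fun x => ENNReal.ofReal (p x))]
    [IsFiniteMeasure (μ.withDensity fun x => ENNReal.ofReal (q x))] :
    InformationTheory.klDiv (μ.withDensity fun x => ENNReal.ofReal (p x))
        (μ.withDensity fun x => ENNReal.ofReal (q x)) =
      ∫⁻ x, ENNReal.ofReal (klIntegrand (p x) (q x)) ∂μ := by
  have hac : (μ.withDensity fun x => ENNReal.ofReal (p x)) ≪
      μ.withDensity fun x => ENNReal.ofReal (q x) := by
    rw [← withDensity_ofReal_div hp hq hq0 hpq]
    exact withDensity_absolutelyContinuous _ _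
  have hm : Measurable fun x => ENNReal.ofReal (InformationTheory.klFun (p x / q x)) :=
    (InformationTheory.measurable_klFun.comp (hp.div hq)).ennreal_ofReal
  rw [InformationTheory.klDiv_eq_lintegral_klFun_of_ac hac,
    lintegral_congr_ae (g := fun x => ENNReal.ofReal (InformationTheory.klFun (p x / q x))),
    lintegral_withDensity_eq_lintegral_mul _ (by fun_prop) hm]
  · refine lintegral_congr fun x => ?_
    rw [Pi.mul_apply, ← ENNReal.ofReal_mul (hq0 x), klIntegrand]
  · filter_upwards [rnDeriv_withDensity_ofReal (μ := μ) hp hq hq0 hpq] with x hx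
    rw [hx, ENNReal.toReal_ofReal (div_nonneg (hp0 x) (hq0 x))]

lemma withDensity_finset_sum {κ : Type*} (s : Finset κ) (f : κ → α → ℝ≥0∞)
    (hf : ∀ k, Measurable (f k)) :
    μ.withDensity (fun x => ∑ k ∈ s, f k x) = ∑ k ∈ s, μ.withDensity (f k) := by
  classical
  induction s using Finset.induction_on with
  | empty => simp [← Pi.zero_def]
  | insert k s hk ih =>
    rw [Finset.sum_insert hk, ← ih, ← withDensity_add_left (hf k)]
    congr 1
    ext x
    rw [Finset.sum_insert hk]
    rfl

lemma pi_withDensity {ι : Type*} [Fintype ι] [IsProbabilityMeasure μ] (f : ι → α → ℝ≥0∞)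
    (hf : ∀ i, Measurable (f i)) [∀ i, SigmaFinite (μ.withDensity (f i))] :
    Measure.pi (fun i => μ.withDensity (f i)) =
      (Measure.pi fun _ : ι => μ).withDensity fun x => ∏ i, f i (x i) := by
  refine Measure.pi_eq fun s hs => ?_
  rw [withDensity_apply _ (MeasurableSet.univ_pi hs), ← lintegral_indicator
    (MeasurableSet.univ_pi hs)]
  have h1 : ∀ x : ι → α, (Set.univ.pi s).indicator (fun x => ∏ i, f i (x i)) x =
      ∏ i, (s i).indicator (f i) (x i) := by
    intro x
    by_cases hx : x ∈ Set.univ.pi s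
    · rw [Set.indicator_of_mem hx]
      exact Finset.prod_congr rfl fun i _ => (Set.indicator_of_mem (hx i trivial) _).symm
    · rw [Set.indicator_of_notMem hx]
      simp only [Set.mem_pi, Set.mem_univ, true_imp_iff, not_forall] at hx
      obtain ⟨i, hi⟩ := hx
      exact (Finset.prod_eq_zero (Finset.mem_univ i) (Set.indicator_of_notMem hi _)).symm
  simp_rw [h1]
  have hm : ∀ i, Measurable ((s i).indicator (f i)) := fun i => (hf i).indicator (hs i)
  rw [lintegral_prod_eq_prod_lintegral_of_indepFun Finset.univ
    (fun i (x : ι → α) => (s i).indicator (f i) (x i))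
    (iIndepFun_pi fun i => (hm i).aemeasurable) (fun i => (hm i).comp (measurable_pi_apply i))]
  refine Finset.prod_congr rfl fun i _ => ?_
  rw [(measurePreserving_eval (fun _ : ι => μ) i).lintegral_comp (hm i),
    lintegral_indicator (hs i), withDensity_apply _ (hs i)]

lemma dirac_eq_withDensity_count {γ : Type*} [Fintype γ] [DecidableEq γ] [MeasurableSpace γ]
    [MeasurableSingletonClass γ] (c : γ) :
    Measure.dirac c = Measure.count.withDensity fun d => if c = d then 1 else 0 := by
  refine Measure.ext_of_singleton fun d => ?_
  rw [withDensity_apply _ (measurableSet_singleton d), Measure.dirac_apply' _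
    (measurableSet_singleton d)]
  simp [Set.indicator_apply]

lemma map_withDensity_involutive {π : α → α} (hπ : MeasurePreserving π μ μ)
    (hinv : Function.Involutive π) {h : α → ℝ≥0∞} (hh : Measurable h) :
    (μ.withDensity h).map π = μ.withDensity fun x => h (π x) := by
  ext s hs
  have hm : Measurable fun x => h (π x) := hh.comp hπ.measurable
  rw [Measure.map_apply hπ.measurable hs, withDensity_apply _ (hπ.measurable hs),
    withDensity_apply _ hs, ← hπ.setLIntegral_comp_preimage hs hm]
  simp only [hinv _]

end Density

/-- A BMS channel has transition densities, with respect to a probability measure, that are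
exchanged by a measure preserving map. -/
lemma IsBMS.exists_density {𝓩 : Type*} [MeasurableSpace 𝓩] {W : Kernel (ZMod 2) 𝓩}
    (hW : IsBMS W) :
    ∃ (μ : Measure 𝓩) (π : 𝓩 → 𝓩) (f : ZMod 2 → 𝓩 → ℝ), IsProbabilityMeasure μ ∧
      MeasurePreserving π μ μ ∧ (∀ b, Measurable (f b)) ∧ (∀ b z, 0 ≤ f b z) ∧
      (∀ b z, f b (π z) = f (b + 1) z) ∧
      ∀ b, W b = μ.withDensity fun z => ENNReal.ofReal (f b z) := by
  obtain ⟨hM, π, hπ, hinv, hsymm⟩ := hW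
  have hsymm' : W 0 = (W 1).map π := by
    rw [hsymm, Measure.map_map hπ hπ, hinv.comp_self, Measure.map_id]
  have hcases : ∀ b : ZMod 2, b = 0 ∨ b = 1 := by decide
  -- The even mixture dominates both output laws and is invariant under `π`, which swaps them.
  set μ : Measure 𝓩 := (2 : ℝ≥0∞)⁻¹ • (W 0 + W 1) with hμ
  have hprob : IsProbabilityMeasure μ := by
    constructor
    simp only [hμ, Measure.smul_apply, Measure.add_apply, measure_univ, smul_eq_mul]
    rw [one_add_one_eq_two]
    exact ENNReal.inv_mul_cancel (by simp) (by simp)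
  have hpres : MeasurePreserving π μ μ := by
    refine ⟨hπ, ?_⟩
    rw [hμ, Measure.map_smul, Measure.map_add _ _ hπ, ← hsymm, ← hsymm', add_comm]
  have hac : W 0 ≪ μ := by
    refine Measure.AbsolutelyContinuous.mk fun s _ hs => ?_
    simp only [hμ, Measure.smul_apply, Measure.add_apply, smul_eq_mul, mul_eq_zero,
      ENNReal.inv_eq_zero, ENNReal.ofNat_ne_top, add_eq_zero, false_or] at hs
    exact hs.1
  set f₀ : 𝓩 → ℝ := fun z => ((W 0).rnDeriv μ z).toReal
  have hf₀ : Measurable f₀ := (Measure.measurable_rnDeriv _ _).ennreal_toReal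
  have h0 : W 0 = μ.withDensity fun z => ENNReal.ofReal (f₀ z) := by
    rw [← Measure.withDensity_rnDeriv_eq _ _ hac]
    refine withDensity_congr_ae ?_
    filter_upwards [Measure.rnDeriv_lt_top (W 0) μ] with z hz
    rw [ENNReal.ofReal_toReal hz.ne]
  have h1 : W 1 = μ.withDensity fun z => ENNReal.ofReal (f₀ (π z)) := by
    rw [hsymm, h0, map_withDensity_involutive hpres hinv (by fun_prop)]
  -- The density for input 1 is taken to be `f₀ ∘ π`, so that the exchange identity holds everywhere
  -- and not just almost everywhere.
  refine ⟨μ, π, fun b z => if b = 0 then f₀ z else f₀ (π z), hprob, hpres, ?_, ?_, ?_, ?_⟩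
  · intro b
    by_cases hb : b = 0
    · simpa [hb] using hf₀
    · simpa [hb, Function.comp_def] using hf₀.comp hπ
  · intro b z
    dsimp only
    split_ifs <;> exact ENNReal.toReal_nonneg
  · intro b z
    rcases hcases b with rfl | rfl
    · simp
    · simp [hinv z, show (1 : ZMod 2) + 1 = 0 by decide]
  · intro b
    rcases hcases b with rfl | rfl
    · simpa using h0
    · simpa using h1

/-! ### Densities of the combined channel and of its subchannels -/

section Pointwise

variable {𝓩 : Type*} {f : ZMod 2 → 𝓩 → ℝ} {m : ℕ}

/-- The density of the output word `z` of the combined channel, given the input `u`. -/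
def wordDensity (f : ZMod 2 → 𝓩 → ℝ) (m : ℕ) (z : Fin (2 ^ m) → 𝓩)
    (u : Fin (2 ^ m) → ZMod 2) : ℝ :=
  ∏ j, f (Matrix.vecMul u (polarMatrix m) j) (z j)

lemma wordDensity_nonneg (hf0 : ∀ b z, 0 ≤ f b z) (z : Fin (2 ^ m) → 𝓩)
    (u : Fin (2 ^ m) → ZMod 2) : 0 ≤ wordDensity f m z u :=
  Finset.prod_nonneg fun _ _ => hf0 _ _

/-- Translating the input amounts to flipping the outputs at the flipped code symbols. -/
lemma wordDensity_add {π : 𝓩 → 𝓩} (hπf : ∀ b z, f b (π z) = f (b + 1) z)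
    (z : Fin (2 ^ m) → 𝓩) (u a : Fin (2 ^ m) → ZMod 2) :
    wordDensity f m z (u + a) = wordDensity f m
      (fun j => if Matrix.vecMul a (polarMatrix m) j = 0 then z j else π (z j)) u := by
  unfold wordDensity
  refine Finset.prod_congr rfl fun j _ => ?_
  rw [Matrix.add_vecMul, Pi.add_apply]
  have hcases : ∀ b : ZMod 2, b = 0 ∨ b = 1 := by decide
  rcases hcases (Matrix.vecMul a (polarMatrix m) j) with h | h
  · simp [h]
  · simp [h, hπf]

/-- The transition density of the `i`-th subchannel. -/
def subchannelDensity (f : ZMod 2 → 𝓩 → ℝ) (m : ℕ) (i : Fin (2 ^ m)) (b : ZMod 2)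
    (x : (Fin (2 ^ m) → 𝓩) × ({j : Fin (2 ^ m) // j < i} → ZMod 2)) : ℝ :=
  (2 ^ (2 ^ m - 1) : ℝ)⁻¹ * ∑ u : Fin (2 ^ m) → ZMod 2 with
    u i = b ∧ (fun j : {j : Fin (2 ^ m) // j < i} => u j) = x.2, wordDensity f m x.1 u

lemma subchannelDensity_nonneg (hf0 : ∀ b z, 0 ≤ f b z) (i : Fin (2 ^ m)) (b : ZMod 2)
    (x : (Fin (2 ^ m) → 𝓩) × ({j : Fin (2 ^ m) // j < i} → ZMod 2)) :
    0 ≤ subchannelDensity f m i b x :=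
  mul_nonneg (by positivity) (Finset.sum_nonneg fun _ _ => wordDensity_nonneg hf0 _ _)

end Pointwise

section WordDensity

variable {𝓩 : Type*} [MeasurableSpace 𝓩] {μ : Measure 𝓩} [IsProbabilityMeasure μ]
  {f : ZMod 2 → 𝓩 → ℝ} {W : Kernel (ZMod 2) 𝓩} {m : ℕ}

lemma measurable_wordDensity (hf : ∀ b, Measurable (f b)) (u : Fin (2 ^ m) → ZMod 2) :
    Measurable fun z => wordDensity f m z u := by
  unfold wordDensity
  exact Finset.measurable_prod _ fun j _ => (hf _).comp (measurable_pi_apply j)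

lemma measurable_cubeAvg_wordDensity (hf : ∀ b, Measurable (f b)) (T : Finset (Fin (2 ^ m)))
    (u : Fin (2 ^ m) → ZMod 2) : Measurable fun z => cubeAvg T (wordDensity f m z) u := by
  unfold cubeAvg
  exact (Finset.measurable_sum _ fun w _ => measurable_wordDensity hf _).const_mul _

lemma combinedChannel_eq_withDensity (hf : ∀ b, Measurable (f b)) (hf0 : ∀ b z, 0 ≤ f b z)
    (hW : ∀ b, W b = μ.withDensity fun z => ENNReal.ofReal (f b z)) (u : Fin (2 ^ m) → ZMod 2) :
    combinedChannel W m u = (Measure.pi fun _ => μ).withDensity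
      fun z => ENNReal.ofReal (wordDensity f m z u) := by
  have hσ : ∀ b, SigmaFinite (μ.withDensity fun z => ENNReal.ofReal (f b z)) := fun b =>
    SigmaFinite.withDensity_ofReal (f b)
  change Measure.pi (fun i => W (Matrix.vecMul u (polarMatrix m) i)) = _
  simp only [hW]
  rw [pi_withDensity _ fun i => (hf _).ennreal_ofReal]
  congr 1
  ext z
  exact (ENNReal.ofReal_prod_of_nonneg fun _ _ => hf0 _ _).symm

lemma lintegral_wordDensity [IsMarkovKernel W] (hf : ∀ b, Measurable (f b))
    (hf0 : ∀ b z, 0 ≤ f b z)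
    (hW : ∀ b, W b = μ.withDensity fun z => ENNReal.ofReal (f b z)) (u : Fin (2 ^ m) → ZMod 2) :
    ∫⁻ z, ENNReal.ofReal (wordDensity f m z u) ∂(Measure.pi fun _ => μ) = 1 := by
  have h : combinedChannel W m u Set.univ = 1 := measure_univ
  rwa [combinedChannel_eq_withDensity hf hf0 hW, withDensity_apply _ MeasurableSet.univ,
    Measure.restrict_univ] at h

lemma integrable_wordDensity [IsMarkovKernel W] (hf : ∀ b, Measurable (f b))
    (hf0 : ∀ b z, 0 ≤ f b z)
    (hW : ∀ b, W b = μ.withDensity fun z => ENNReal.ofReal (f b z)) (u : Fin (2 ^ m) → ZMod 2) :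
    Integrable (fun z => wordDensity f m z u) (Measure.pi fun _ => μ) := by
  refine ⟨(measurable_wordDensity hf u).aestronglyMeasurable, ?_⟩
  rw [hasFiniteIntegral_iff_ofReal (.of_forall fun z => wordDensity_nonneg hf0 z u),
    lintegral_wordDensity hf hf0 hW]
  exact ENNReal.one_lt_top

lemma integral_wordDensity [IsMarkovKernel W] (hf : ∀ b, Measurable (f b))
    (hf0 : ∀ b z, 0 ≤ f b z)
    (hW : ∀ b, W b = μ.withDensity fun z => ENNReal.ofReal (f b z)) (u : Fin (2 ^ m) → ZMod 2) :
    ∫ z, wordDensity f m z u ∂(Measure.pi fun _ => μ) = 1 := by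
  rw [integral_eq_lintegral_of_nonneg_ae (.of_forall fun z => wordDensity_nonneg hf0 z u)
    (measurable_wordDensity hf u).aestronglyMeasurable, lintegral_wordDensity hf hf0 hW]
  simp

lemma integrable_cubeAvg_wordDensity [IsMarkovKernel W] (hf : ∀ b, Measurable (f b))
    (hf0 : ∀ b z, 0 ≤ f b z)
    (hW : ∀ b, W b = μ.withDensity fun z => ENNReal.ofReal (f b z))
    (T : Finset (Fin (2 ^ m))) (u : Fin (2 ^ m) → ZMod 2) :
    Integrable (fun z => cubeAvg T (wordDensity f m z) u) (Measure.pi fun _ => μ) := by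
  unfold cubeAvg
  exact (integrable_finsetSum _ fun w _ => integrable_wordDensity hf hf0 hW _).const_mul _

lemma subchannel_eq_withDensity (hf : ∀ b, Measurable (f b)) (hf0 : ∀ b z, 0 ≤ f b z)
    (hW : ∀ b, W b = μ.withDensity fun z => ENNReal.ofReal (f b z)) (i : Fin (2 ^ m))
    (b : ZMod 2) :
    subchannel W m i b = ((Measure.pi fun _ => μ).prod Measure.count).withDensity
      fun x => ENNReal.ofReal (subchannelDensity f m i b x) := by
  set c : ℝ≥0∞ := ((2 : ℝ≥0∞) ^ (2 ^ m - 1))⁻¹ with hc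
  change ∑ u : Fin (2 ^ m) → ZMod 2 with u i = b, c •
        (combinedChannel W m u).prod (Measure.dirac fun j : {j : Fin (2 ^ m) // j < i} => u j) = _
  have hm : ∀ u, Measurable fun z => ENNReal.ofReal (wordDensity f m z u) := fun u =>
    (measurable_wordDensity hf u).ennreal_ofReal
  have hm1 : ∀ u : Fin (2 ^ m) → ZMod 2,
      Measurable fun d : {j : Fin (2 ^ m) // j < i} → ZMod 2 =>
        if (fun j : {j : Fin (2 ^ m) // j < i} => u j) = d then (1 : ℝ≥0∞) else 0 :=
    fun u => measurable_of_finite _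
  have hm2 : ∀ u : Fin (2 ^ m) → ZMod 2,
      Measurable fun x : (Fin (2 ^ m) → 𝓩) × ({j : Fin (2 ^ m) // j < i} → ZMod 2) =>
        ENNReal.ofReal (wordDensity f m x.1 u) *
          if (fun j : {j : Fin (2 ^ m) // j < i} => u j) = x.2 then (1 : ℝ≥0∞) else 0 :=
    fun u => ((hm u).comp measurable_fst).mul ((hm1 u).comp measurable_snd)
  have hterm : ∀ u : Fin (2 ^ m) → ZMod 2, c • (combinedChannel W m u).prod
      (Measure.dirac fun j : {j : Fin (2 ^ m) // j < i} => u j) =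
      ((Measure.pi fun _ => μ).prod Measure.count).withDensity
        (c • fun x => ENNReal.ofReal (wordDensity f m x.1 u) *
          if (fun j : {j : Fin (2 ^ m) // j < i} => u j) = x.2 then 1 else 0) := by
    intro u
    rw [combinedChannel_eq_withDensity hf hf0 hW, dirac_eq_withDensity_count,
      prod_withDensity (hm u) (hm1 u), withDensity_smul _ (hm2 u)]
  simp only [hterm]
  rw [← withDensity_finset_sum _ _ fun u => (hm2 u).const_smul c]
  congr 1
  ext x
  have hc' : ENNReal.ofReal ((2 ^ (2 ^ m - 1) : ℝ)⁻¹) = c := by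
    rw [ENNReal.ofReal_inv_of_pos (by positivity), ENNReal.ofReal_pow (by norm_num), hc]
    simp
  rw [subchannelDensity, ENNReal.ofReal_mul (by positivity), hc',
    ENNReal.ofReal_sum_of_nonneg (fun u _ => wordDensity_nonneg hf0 _ _), ← Finset.filter_filter,
    Finset.sum_filter (s := Finset.univ.filter _), Finset.mul_sum]
  simp only [Pi.smul_apply, smul_eq_mul, mul_ite, mul_one, mul_zero]

lemma measurable_subchannelDensity (hf : ∀ b, Measurable (f b)) (i : Fin (2 ^ m)) (b : ZMod 2) :
    Measurable (subchannelDensity f m i b) := by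
  refine measurable_from_prod_countable_left fun v => ?_
  simp only [subchannelDensity, Finset.sum_filter]
  refine Measurable.const_mul (Finset.measurable_sum _ fun u _ => ?_) _
  by_cases h : u i = b ∧ (fun j : {j : Fin (2 ^ m) // j < i} => u j) = v
  · simpa only [if_pos h] using measurable_wordDensity hf u
  · simpa only [if_neg h] using measurable_const

end WordDensity

/-! ### Counting words with prescribed coordinates. -/

section Fibers

variable {ι : Type*} [Fintype ι] [DecidableEq ι]

lemma sum_piecewise_eq_sum_fiber (T : Finset ι) (g : (ι → ZMod 2) → ℝ) (u : ι → ZMod 2) :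
    ∑ w : ι → ZMod 2, g (T.piecewise u w) =
      2 ^ T.card * ∑ v : ι → ZMod 2 with ∀ j ∈ T, v j = u j, g v := by
  have hmaps : ∀ w ∈ (Finset.univ : Finset (ι → ZMod 2)), T.piecewise u w ∈
      Finset.univ.filter fun v : ι → ZMod 2 => ∀ j ∈ T, v j = u j := by
    intro w _
    simp +contextual
  rw [← Finset.sum_fiberwise_of_maps_to hmaps, Finset.mul_sum]
  refine Finset.sum_congr rfl fun v hv => ?_
  have hv' : ∀ j ∈ T, v j = u j := by simpa using hv
  rw [Finset.sum_congr rfl fun w hw => by rw [(Finset.mem_filter.1 hw).2], Finset.sum_const,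
    nsmul_eq_mul]
  congr 1
  -- A word `w` over `v` is free on `T` and forced outside it, which gives `2 ^ T.card` choices.
  have hset : (Finset.univ.filter fun w : ι → ZMod 2 => T.piecewise u w = v) =
      Fintype.piFinset fun j => if j ∈ T then Finset.univ else {v j} := by
    ext w
    simp only [Finset.mem_filter, Finset.mem_univ, true_and, Fintype.mem_piFinset, funext_iff]
    refine forall_congr' fun j => ?_
    by_cases hj : j ∈ T
    · simp [hj, hv' j hj]
    · simp [hj]
  rw [hset, Fintype.card_piFinset]
  have : ∀ j, (if j ∈ T then (Finset.univ : Finset (ZMod 2)) else {v j}).card =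
      if j ∈ T then 2 else 1 := by
    intro j
    split_ifs <;> simp [ZMod.card]
  simp [this]

lemma two_pow_mul_card_fiber (T : Finset ι) (u : ι → ZMod 2) :
    (2 : ℝ) ^ T.card * (Finset.univ.filter fun v : ι → ZMod 2 => ∀ j ∈ T, v j = u j).card =
      2 ^ Fintype.card ι := by
  have h := sum_piecewise_eq_sum_fiber T (fun _ => 1) u
  rw [sum_cube_const] at h
  simpa using h.symm

end Fibers

/-- Each assignment of the past bits extends to `2 ^ (n - |Iio i|)` words; the power is moved to the
left to avoid subtraction. -/
lemma two_pow_mul_sum_restrict {n : ℕ} (i : Fin n) (φ : ({j : Fin n // j < i} → ZMod 2) → ℝ) :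
    (2 : ℝ) ^ (Finset.Iio i).card * ∑ u : Fin n → ZMod 2, φ (fun j => u j) =
      2 ^ n * ∑ v, φ v := by
  rw [← Finset.sum_fiberwise Finset.univ
    (fun (u : Fin n → ZMod 2) (j : {j : Fin n // j < i}) => u j), Finset.mul_sum, Finset.mul_sum]
  refine Finset.sum_congr rfl fun v _ => ?_
  rw [Finset.sum_congr rfl fun w hw => by rw [(Finset.mem_filter.1 hw).2], Finset.sum_const,
    nsmul_eq_mul, ← mul_assoc]
  congr 1
  have h := two_pow_mul_card_fiber (Finset.Iio i)
    (fun j => if h : j < i then v ⟨j, h⟩ else 0)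
  rw [Fintype.card_fin] at h
  rw [← h]
  congr 3
  ext w
  simp only [Finset.mem_filter, Finset.mem_univ, true_and, Finset.mem_Iio, funext_iff,
    Subtype.forall]
  refine forall_congr' fun j => forall_congr' fun hj => ?_
  simp [hj]

/-! ### Bhattacharyya parameters of the subchannels as averages over the cube. -/

section Subchannel

variable {𝓩 : Type*} {f : ZMod 2 → 𝓩 → ℝ} {m : ℕ}

/-- Both sides sum the word density over the same fiber; the factor is `2^{-N} * 2^{|Iio i| + 1}`
divided by `2^{-(N-1)}`. -/
lemma cubeAvg_insert_Iio_eq_subchannelDensity (i : Fin (2 ^ m)) (z : Fin (2 ^ m) → 𝓩)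
    (u : Fin (2 ^ m) → ZMod 2) :
    cubeAvg (insert i (Finset.Iio i)) (wordDensity f m z) u =
      2 ^ (Finset.Iio i).card * subchannelDensity f m i (u i) (z, fun j => u j.1) := by
  have hcard : (insert i (Finset.Iio i)).card = (Finset.Iio i).card + 1 :=
    Finset.card_insert_of_notMem (by simp)
  have hpow : (2 : ℝ) ^ (2 ^ m) = 2 ^ (2 ^ m - 1) * 2 := by
    rw [← pow_succ, Nat.sub_add_cancel Nat.one_le_two_pow]
  rw [cubeAvg, sum_piecewise_eq_sum_fiber, hcard, subchannelDensity, Fintype.card_fin, hpow]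
  have key : ∀ A c x y : ℝ, A ≠ 0 → x = y → (A * 2)⁻¹ * (c * 2 * x) = c * (A⁻¹ * y) := by
    rintro A c x _ hA rfl
    field_simp
  rw [pow_succ]
  refine key _ _ _ _ (by positivity) (Finset.sum_congr ?_ fun _ _ => rfl)
  ext v
  simp only [Finset.mem_filter, Finset.mem_univ, true_and, Finset.forall_mem_insert,
    Finset.mem_Iio, funext_iff, Subtype.forall]

lemma sum_sqrt_subchannelDensity (i : Fin (2 ^ m)) (z : Fin (2 ^ m) → 𝓩) :
    ∑ v, √(subchannelDensity f m i 0 (z, v) * subchannelDensity f m i 1 (z, v)) =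
      (2 ^ (2 ^ m) : ℝ)⁻¹ * ∑ u, √(cubeAvg (insert i (Finset.Iio i)) (wordDensity f m z) u *
        cubeAvg (insert i (Finset.Iio i)) (wordDensity f m z) (u + Pi.single i 1)) := by
  have h := two_pow_mul_sum_restrict i
    (fun v => √(subchannelDensity f m i 0 (z, v) * subchannelDensity f m i 1 (z, v)))
  -- Flipping bit `i` keeps the past and exchanges the inputs 0 and 1 of the subchannel; the square
  -- root is symmetric in the two.
  have hu : ∀ u : Fin (2 ^ m) → ZMod 2,
      √(cubeAvg (insert i (Finset.Iio i)) (wordDensity f m z) u *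
        cubeAvg (insert i (Finset.Iio i)) (wordDensity f m z) (u + Pi.single i 1)) =
      2 ^ (Finset.Iio i).card * √(subchannelDensity f m i 0 (z, fun j => u j.1) *
        subchannelDensity f m i 1 (z, fun j => u j.1)) := by
    intro u
    rw [cubeAvg_insert_Iio_eq_subchannelDensity, cubeAvg_insert_Iio_eq_subchannelDensity]
    have hrest : (fun j : {j : Fin (2 ^ m) // j < i} =>
        (u + Pi.single i 1 : Fin (2 ^ m) → ZMod 2) j) = fun j => u j.1 := by
      ext j
      simp [j.2.ne]
    rw [hrest, Pi.add_apply, Pi.single_eq_same, mul_mul_mul_comm,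
      Real.sqrt_mul (mul_self_nonneg _), Real.sqrt_mul_self (by positivity)]
    have hcases : ∀ b : ZMod 2, b = 0 ∨ b = 1 := by decide
    rcases hcases (u i) with hb | hb
    · rw [hb, zero_add]
    · rw [hb, show (1 : ZMod 2) + 1 = 0 by decide, mul_comm (subchannelDensity f m i 1 _)]
  simp only [hu]
  rw [← Finset.mul_sum, h, inv_mul_cancel_left₀ (by positivity)]

lemma bhattacharyya_subchannel [MeasurableSpace 𝓩] {μ : Measure 𝓩} [IsProbabilityMeasure μ]
    {W : Kernel (ZMod 2) 𝓩} [IsMarkovKernel W]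
    (hf : ∀ b, Measurable (f b)) (hf0 : ∀ b z, 0 ≤ f b z)
    (hW : ∀ b, W b = μ.withDensity fun z => ENNReal.ofReal (f b z)) (i : Fin (2 ^ m)) :
    bhattacharyya (subchannel W m i) = ∫ z, (2 ^ (2 ^ m) : ℝ)⁻¹ *
      ∑ u, √(cubeAvg (insert i (Finset.Iio i)) (wordDensity f m z) u *
        cubeAvg (insert i (Finset.Iio i)) (wordDensity f m z) (u + Pi.single i 1))
      ∂(Measure.pi fun _ => μ) := by
  have hm := measurable_subchannelDensity (m := m) hf i
  have hm0 := subchannelDensity_nonneg (m := m) hf0 i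
  rw [bhattacharyya_eq_integral hm hm0 (subchannel_eq_withDensity hf hf0 hW i)]
  have hint : ∀ b, Integrable (subchannelDensity f m i b)
      ((Measure.pi fun _ => μ).prod Measure.count) := by
    intro b
    refine ⟨(hm b).aestronglyMeasurable, ?_⟩
    rw [hasFiniteIntegral_iff_ofReal (.of_forall (hm0 b)), ← setLIntegral_univ,
      ← withDensity_apply _ MeasurableSet.univ, ← subchannel_eq_withDensity hf hf0 hW i b]
    change (∑ u : Fin (2 ^ m) → ZMod 2 with u i = b, ((2 : ℝ≥0∞) ^ (2 ^ m - 1))⁻¹ •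
        (combinedChannel W m u).prod
          (Measure.dirac fun j : {j : Fin (2 ^ m) // j < i} => u j)) Set.univ < ∞
    rw [Measure.finsetSum_apply]
    refine ENNReal.sum_lt_top.2 fun u _ => ?_
    rw [Measure.smul_apply, measure_univ, smul_eq_mul, mul_one]
    exact ENNReal.inv_lt_top.2 (ENNReal.pow_pos (by norm_num) _)
  have hint' : Integrable (fun x => √(subchannelDensity f m i 0 x * subchannelDensity f m i 1 x))
      ((Measure.pi fun _ => μ).prod Measure.count) := by
    refine ((hint 0).add (hint 1)).mono' ((hm 0).mul (hm 1)).sqrt.aestronglyMeasurable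
      (.of_forall fun x => ?_)
    rw [Real.norm_of_nonneg (Real.sqrt_nonneg _), Pi.add_apply]
    refine Real.sqrt_le_iff.2 ⟨add_nonneg (hm0 0 x) (hm0 1 x), ?_⟩
    nlinarith [hm0 0 x, hm0 1 x, mul_nonneg (hm0 0 x) (hm0 1 x)]
  rw [integral_prod _ hint']
  refine integral_congr_ae (.of_forall fun z => ?_)
  dsimp only
  rw [integral_count, sum_sqrt_subchannelDensity]

end Subchannel

/-! ### The laws of the message and of the observation -/

section JointLaw

variable {Ω α γ 𝓩 : Type*} [MeasurableSpace Ω] [Fintype α] [MeasurableSpace α]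
  [MeasurableSingletonClass α] [MeasurableSpace γ]
  [MeasurableSingletonClass γ] [MeasurableSpace 𝓩] {P : Measure Ω} [IsProbabilityMeasure P]
  {U : Ω → α} {Z : Ω → 𝓩} {κ : Kernel α 𝓩} [IsMarkovKernel κ] {ν : Measure 𝓩}
  {g : 𝓩 → α → ℝ}

lemma map_eq_withDensity_of_hasCondDistrib (hU : Measurable U) (hZ : Measurable Z)
    (h : HasCondDistrib Z U κ P)
    (hg : ∀ u, Measurable fun z => g z u) (hg0 : ∀ z u, 0 ≤ g z u)
    (hκ : ∀ u, κ u = ν.withDensity fun z => ENNReal.ofReal (g z u)) :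
    P.map Z = ν.withDensity fun z =>
      ENNReal.ofReal (∑ u, (P.map U).real {u} * g z u) := by
  have : IsProbabilityMeasure (P.map U) := Measure.isProbabilityMeasure_map hU.aemeasurable
  ext s hs
  have h1 : P.map Z s = (P.map fun ω => (U ω, Z ω)) (Prod.snd ⁻¹' s) := by
    rw [Measure.map_apply hZ hs, Measure.map_apply (hU.prodMk hZ) (measurable_snd hs)]
    rfl
  have hofReal : ∀ z, ENNReal.ofReal (∑ u, (P.map U).real {u} * g z u) =
      ∑ u, P.map U {u} * ENNReal.ofReal (g z u) := by
    intro z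
    rw [ENNReal.ofReal_sum_of_nonneg fun u _ => mul_nonneg measureReal_nonneg (hg0 z u)]
    refine Finset.sum_congr rfl fun u _ => ?_
    rw [ENNReal.ofReal_mul measureReal_nonneg, ofReal_measureReal]
  rw [h1, h.map_eq, Measure.compProd_apply (measurable_snd hs), lintegral_fintype,
    withDensity_apply _ hs]
  simp only [hofReal]
  rw [lintegral_finsetSum _ fun u _ => ((hg u).ennreal_ofReal).const_mul _]
  refine Finset.sum_congr rfl fun u _ => ?_
  rw [lintegral_const_mul _ (hg u).ennreal_ofReal, mul_comm, hκ, ← withDensity_apply _ hs]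
  rfl

lemma map_prodMk_eq_withDensity_of_hasCondDistrib [Fintype γ] [DecidableEq γ] [SFinite ν]
    (hU : Measurable U) (hZ : Measurable Z)
    (h : HasCondDistrib Z U κ P)
    (hg : ∀ u, Measurable fun z => g z u) (hg0 : ∀ z u, 0 ≤ g z u)
    (hκ : ∀ u, κ u = ν.withDensity fun z => ENNReal.ofReal (g z u)) (r : α → γ) :
    P.map (fun ω => (r (U ω), Z ω)) = (Measure.count.prod ν).withDensity fun x =>
      ENNReal.ofReal (∑ u with r u = x.1, (P.map U).real {u} * g x.2 u) := by
  have : IsProbabilityMeasure (P.map U) := Measure.isProbabilityMeasure_map hU.aemeasurable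
  have hr : Measurable r := measurable_of_finite r
  have hrU : Measurable fun ω => r (U ω) := hr.comp hU
  have hofReal : ∀ x : γ × 𝓩, ENNReal.ofReal (∑ u with r u = x.1, (P.map U).real {u} * g x.2 u) =
      ∑ u, P.map U {u} * (ENNReal.ofReal (g x.2 u) * if r u = x.1 then 1 else 0) := by
    intro x
    rw [ENNReal.ofReal_sum_of_nonneg fun u _ => mul_nonneg measureReal_nonneg (hg0 _ u),
      Finset.sum_filter]
    refine Finset.sum_congr rfl fun u _ => ?_
    split_ifs
    · rw [ENNReal.ofReal_mul measureReal_nonneg, ofReal_measureReal, mul_one]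
    · simp
  have hm1 : ∀ u, Measurable fun c : γ => if r u = c then (1 : ℝ≥0∞) else 0 :=
    fun u => measurable_of_finite _
  have hm2 : ∀ u, Measurable fun x : γ × 𝓩 =>
      ENNReal.ofReal (g x.2 u) * if r u = x.1 then (1 : ℝ≥0∞) else 0 :=
    fun u => ((hg u).ennreal_ofReal.comp measurable_snd).mul ((hm1 u).comp measurable_fst)
  have hprod : ∀ u, (Measure.count.prod ν).withDensity (fun x : γ × 𝓩 =>
      ENNReal.ofReal (g x.2 u) * if r u = x.1 then (1 : ℝ≥0∞) else 0) =
      (Measure.dirac (r u)).prod (κ u) := by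
    intro u
    rw [hκ, dirac_eq_withDensity_count, prod_withDensity (hm1 u) (hg u).ennreal_ofReal]
    congr 1
    ext x
    rw [mul_comm]
  simp only [hofReal]
  rw [withDensity_finset_sum _ _ fun u => (hm2 u).const_mul _]
  ext s hs
  have h1 : P.map (fun ω => (r (U ω), Z ω)) s =
      (P.map fun ω => (U ω, Z ω)) (Prod.map r id ⁻¹' s) := by
    rw [Measure.map_apply (hrU.prodMk hZ) hs,
      Measure.map_apply (hU.prodMk hZ) ((hr.prodMap measurable_id) hs)]
    rfl
  rw [h1, h.map_eq, Measure.compProd_apply ((hr.prodMap measurable_id) hs), lintegral_fintype,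
    Measure.finsetSum_apply]
  refine Finset.sum_congr rfl fun u _ => ?_
  have h2 := withDensity_smul (μ := Measure.count.prod ν) (P.map U {u}) (hm2 u)
  rw [hprod] at h2
  rw [mul_comm]
  change _ = (((Measure.count : Measure γ).prod ν).withDensity
    (P.map U {u} • fun x : γ × 𝓩 =>
      ENNReal.ofReal (g x.2 u) * if r u = x.1 then (1 : ℝ≥0∞) else 0)) s
  rw [h2, Measure.smul_apply, smul_eq_mul, Measure.dirac_prod, Measure.map_apply
    measurable_prodMk_left hs]
  rfl

lemma eq_withDensity_count [Fintype γ] (ρ : Measure γ) [IsFiniteMeasure ρ] :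
    ρ = Measure.count.withDensity fun c => ENNReal.ofReal (ρ.real {c}) := by
  refine Measure.ext_of_singleton fun d => ?_
  rw [withDensity_apply _ (measurableSet_singleton d)]
  simp

lemma measureReal_map_singleton [DecidableEq γ] (hU : Measurable U) (r : α → γ) (c : γ) :
    (P.map fun ω => r (U ω)).real {c} = ∑ u with r u = c, (P.map U).real {u} := by
  have : IsProbabilityMeasure (P.map U) := Measure.isProbabilityMeasure_map hU.aemeasurable
  have hr : Measurable r := measurable_of_finite r
  have h1 : P.map (fun ω => r (U ω)) = (P.map U).map r := (Measure.map_map hr hU).symm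
  rw [h1, map_measureReal_apply hr (measurableSet_singleton c), sum_measureReal_singleton]
  congr 1
  ext u
  simp

end JointLaw

/-- Absolute continuity of the joint law with respect to the product of its marginals, at the level
of densities. -/
lemma sum_fiber_mul_eq_zero {α γ : Type*} [Fintype α] [DecidableEq γ] (r : α → γ)
    {a y : α → ℝ} (ha : ∀ u, 0 ≤ a u) (hy : ∀ u, 0 ≤ y u) (c : γ)
    (hc : (∑ u with r u = c, a u) * ∑ u, a u * y u = 0) : ∑ u with r u = c, a u * y u = 0 := by
  have hay : ∀ u, 0 ≤ a u * y u := fun u => mul_nonneg (ha u) (hy u)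
  refine Finset.sum_eq_zero fun u hu => ?_
  rcases mul_eq_zero.1 hc with h | h
  · rw [(Finset.sum_eq_zero_iff_of_nonneg fun v _ => ha v).1 h u hu, zero_mul]
  · exact (Finset.sum_eq_zero_iff_of_nonneg fun v _ => hay v).1 h u (Finset.mem_univ u)

/-- Replacing the output law of a mixture by an arbitrary reference law, and a coarse message by a
fine one, does not decrease the divergence. -/
lemma sum_klIntegrand_le {α γ : Type*} [Fintype α] [Fintype γ] [DecidableEq γ] (r : α → γ)
    {a y : α → ℝ} {q : ℝ} (ha : ∀ u, 0 ≤ a u) (ha1 : ∑ u, a u = 1) (hy : ∀ u, 0 ≤ y u)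
    (hq : 0 ≤ q) (hyq : ∀ u, q = 0 → y u = 0) :
    ∑ c, klIntegrand (∑ u with r u = c, a u * y u) ((∑ u with r u = c, a u) * ∑ u, a u * y u) ≤
      ∑ u, a u * klIntegrand (y u) q := by
  set p : γ → ℝ := fun c => ∑ u with r u = c, a u * y u with hp_def
  set w : γ → ℝ := fun c => ∑ u with r u = c, a u
  set t : ℝ := ∑ u, a u * y u
  have hay : ∀ u, 0 ≤ a u * y u := fun u => mul_nonneg (ha u) (hy u)
  have hp : ∀ c, 0 ≤ p c := fun c => Finset.sum_nonneg fun u _ => hay u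
  have hw : ∀ c, 0 ≤ w c := fun c => Finset.sum_nonneg fun u _ => ha u
  have ht : 0 ≤ t := Finset.sum_nonneg fun u _ => hay u
  have hpt : ∑ c, p c = t := Finset.sum_fiberwise _ r _
  have hw1 : ∑ c, w c = 1 := by rw [← ha1]; exact Finset.sum_fiberwise _ r _
  have hp_pos : ∀ u, 0 < a u * y u → 0 < p (r u) := fun u h =>
    h.trans_le (Finset.single_le_sum (f := fun u => a u * y u) (fun v _ => hay v)
      (Finset.mem_filter.2 ⟨Finset.mem_univ u, rfl⟩))
  have hw_pos : ∀ u, 0 < a u → 0 < w (r u) := fun u h =>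
    h.trans_le (Finset.single_le_sum (fun v _ => ha v)
      (Finset.mem_filter.2 ⟨Finset.mem_univ u, rfl⟩))
  have ht_pos : ∀ u, 0 < a u * y u → 0 < t := fun u h =>
    h.trans_le (Finset.single_le_sum (f := fun u => a u * y u) (fun v _ => hay v)
      (Finset.mem_univ u))
  have hzero : ∀ c, w c * t = 0 → p c = 0 := sum_fiber_mul_eq_zero r ha hy
  have hL : ∑ c, klIntegrand (p c) (w c * t) =
      ∑ u, a u * y u * (Real.log (p (r u)) - Real.log (w (r u) * t)) := by
    have h1 : ∀ c, klIntegrand (p c) (w c * t) =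
        p c * (Real.log (p c) - Real.log (w c * t)) + w c * t - p c :=
      fun c => klIntegrand_eq (hzero c)
    simp only [h1]
    rw [Finset.sum_sub_distrib, Finset.sum_add_distrib, ← Finset.sum_mul, hw1, hpt, one_mul,
      add_sub_cancel_right, ← Finset.sum_fiberwise Finset.univ r]
    refine Finset.sum_congr rfl fun c _ => ?_
    rw [hp_def]
    dsimp only
    rw [Finset.sum_mul]
    refine Finset.sum_congr rfl fun u hu => ?_
    rw [(Finset.mem_filter.1 hu).2]
  have hR : ∑ u, a u * klIntegrand (y u) q =
      ∑ u, a u * y u * (Real.log (y u) - Real.log q) + q - t := by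
    have h1 : ∀ u, a u * klIntegrand (y u) q =
        a u * y u * (Real.log (y u) - Real.log q) + a u * q - a u * y u := by
      intro u
      rw [klIntegrand_eq (hyq u)]
      ring
    simp only [h1]
    rw [Finset.sum_sub_distrib, Finset.sum_add_distrib, ← Finset.sum_mul, ha1, one_mul]
  -- The gap between the two sides is the divergence of the weights `a u * y u` from `a u * (p / w)
  -- * (q / t)`; `hsum` below bounds the mass of the latter by `q`.
  have hterm : ∀ u, a u * y u * (Real.log (p (r u)) - Real.log (w (r u) * t)) -
      a u * y u * (Real.log (y u) - Real.log q) ≤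
      a u * (p (r u) / w (r u)) * (q / t) - a u * y u := by
    intro u
    rcases (hay u).eq_or_lt with h0 | hpos
    · rw [← h0]
      simp only [zero_mul, sub_zero]
      exact mul_nonneg (mul_nonneg (ha u) (div_nonneg (hp _) (hw _))) (div_nonneg hq ht)
    have pa : 0 < a u := (ha u).lt_of_ne' (left_ne_zero_of_mul hpos.ne')
    have py : 0 < y u := (hy u).lt_of_ne' (right_ne_zero_of_mul hpos.ne')
    have pp := hp_pos u hpos
    have pw := hw_pos u pa
    have pt := ht_pos u hpos
    have pq : 0 < q := hq.lt_of_ne' fun h => py.ne' (hyq u h)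
    have h1 := Real.log_le_sub_one_of_pos (x := p (r u) * q / (w (r u) * t * y u)) (by positivity)
    rw [Real.log_div (by positivity) (by positivity), Real.log_mul pp.ne' pq.ne',
      Real.log_mul (mul_pos pw pt).ne' py.ne'] at h1
    have h2 := mul_le_mul_of_nonneg_left h1 hpos.le
    have h3 : a u * y u * (p (r u) * q / (w (r u) * t * y u) - 1) =
        a u * (p (r u) / w (r u)) * (q / t) - a u * y u := by
      field_simp
    linarith
  have hsum : ∑ u, a u * (p (r u) / w (r u)) * (q / t) ≤ q := by
    rw [← Finset.sum_mul]
    have h1 : ∑ u, a u * (p (r u) / w (r u)) ≤ t := by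
      rw [← hpt, ← Finset.sum_fiberwise Finset.univ r]
      refine Finset.sum_le_sum fun c _ => ?_
      rw [Finset.sum_congr rfl fun u hu => by rw [(Finset.mem_filter.1 hu).2], ← Finset.sum_mul]
      change w c * (p c / w c) ≤ p c
      rcases (hw c).eq_or_lt with h | h
      · rw [← h, zero_mul]; exact hp c
      · rw [mul_div_cancel₀ _ h.ne']
    rcases ht.eq_or_lt with h | h
    · rw [← h]; simpa using hq
    · calc _ ≤ t * (q / t) := mul_le_mul_of_nonneg_right h1 (div_nonneg hq ht)
        _ = q := mul_div_cancel₀ _ h.ne'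
  rw [hL, hR]
  have := Finset.sum_le_sum fun u (_ : u ∈ Finset.univ) => hterm u
  rw [Finset.sum_sub_distrib, Finset.sum_sub_distrib] at this
  linarith

/-! ### The leakage bound -/

section Leakage

variable {𝓩 : Type*} [MeasurableSpace 𝓩] {μ : Measure 𝓩} [IsProbabilityMeasure μ]
  {f : ZMod 2 → 𝓩 → ℝ} {W : Kernel (ZMod 2) 𝓩} {m : ℕ}

lemma measurable_klIntegrand_cubeAvg (hf : ∀ b, Measurable (f b)) (S : Finset (Fin (2 ^ m)))
    (u : Fin (2 ^ m) → ZMod 2) :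
    Measurable fun z =>
      klIntegrand (cubeAvg S (wordDensity f m z) u) (cubeAvg ∅ (wordDensity f m z) u) :=
  measurable_klIntegrand (measurable_cubeAvg_wordDensity hf S u)
    (measurable_cubeAvg_wordDensity hf ∅ u)

lemma integrable_klIntegrand_cubeAvg [IsMarkovKernel W] (hf : ∀ b, Measurable (f b))
    (hf0 : ∀ b z, 0 ≤ f b z)
    (hW : ∀ b, W b = μ.withDensity fun z => ENNReal.ofReal (f b z)) (S : Finset (Fin (2 ^ m)))
    (u : Fin (2 ^ m) → ZMod 2) :
    Integrable (fun z =>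
      klIntegrand (cubeAvg S (wordDensity f m z) u) (cubeAvg ∅ (wordDensity f m z) u))
      (Measure.pi fun _ => μ) := by
  refine ((integrable_cubeAvg_wordDensity hf hf0 hW ∅ u).const_mul
    ((2 ^ Fintype.card (Fin (2 ^ m)) : ℝ) ^ 2 + 1)).mono'
    (measurable_klIntegrand_cubeAvg hf S u).aestronglyMeasurable (.of_forall fun z => ?_)
  have hg := wordDensity_nonneg (m := m) hf0 z
  rw [Real.norm_of_nonneg (klIntegrand_nonneg (cubeAvg_nonneg S hg u) (cubeAvg_nonneg ∅ hg u))]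
  exact klIntegrand_le (cubeAvg_nonneg S hg u) (cubeAvg_nonneg ∅ hg u) (by positivity)
    (cubeAvg_le_cubeAvg_empty S hg u u)

/-- By symmetry of the channel, the divergence of the output law given the coordinates in `S` from
the output law of a uniform input does not depend on the value of these coordinates. -/
lemma integral_klIntegrand_cubeAvg_eq (hf : ∀ b, Measurable (f b))
    {π : 𝓩 → 𝓩} (hπ : MeasurePreserving π μ μ) (hπf : ∀ b z, f b (π z) = f (b + 1) z)
    (S : Finset (Fin (2 ^ m))) (u : Fin (2 ^ m) → ZMod 2) :
    ∫ z, klIntegrand (cubeAvg S (wordDensity f m z) u) (cubeAvg ∅ (wordDensity f m z) u)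
        ∂(Measure.pi fun _ => μ) =
      ∫ z, klIntegrand (cubeAvg S (wordDensity f m z) 0) (cubeAvg ∅ (wordDensity f m z) 0)
        ∂(Measure.pi fun _ => μ) := by
  -- The output map applies `π` exactly at the positions where the codeword of `u` is 1; it undoes
  -- the translation of the input by `u`.
  have hpres : MeasurePreserving (fun (z : Fin (2 ^ m) → 𝓩) j =>
      (if Matrix.vecMul u (polarMatrix m) j = 0 then id else π) (z j))
      (Measure.pi fun _ => μ) (Measure.pi fun _ => μ) := by
    refine measurePreserving_pi _ _ fun j => ?_
    split_ifs
    · exact MeasurePreserving.id μ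
    · exact hπ
  have hword : ∀ z, (fun v => wordDensity f m z (v + u)) = wordDensity f m
      (fun j => (if Matrix.vecMul u (polarMatrix m) j = 0 then id else π) (z j)) := by
    intro z
    ext v
    rw [wordDensity_add hπf]
    congr 1
    ext j
    split_ifs <;> rfl
  have hshift : ∀ (T : Finset (Fin (2 ^ m))) z, cubeAvg T (wordDensity f m z) u =
      cubeAvg T (wordDensity f m
        (fun j => (if Matrix.vecMul u (polarMatrix m) j = 0 then id else π) (z j))) 0 := by
    intro T z
    rw [← hword, ← cubeAvg_add_right, zero_add]
  simp only [hshift _ _]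
  have h := integral_map (μ := Measure.pi fun _ : Fin (2 ^ m) => μ) hpres.measurable.aemeasurable
    (measurable_klIntegrand_cubeAvg hf S 0).aestronglyMeasurable
  rw [hpres.map_eq] at h
  exact h.symm

/-- The divergence of the output law given the coordinates in `S`, bounded by the Bhattacharyya
parameters of the corresponding subchannels. -/
lemma integral_klIntegrand_cubeAvg_le [IsMarkovKernel W] (hf : ∀ b, Measurable (f b))
    (hf0 : ∀ b z, 0 ≤ f b z)
    (hW : ∀ b, W b = μ.withDensity fun z => ENNReal.ofReal (f b z))
    {π : 𝓩 → 𝓩} (hπ : MeasurePreserving π μ μ) (hπf : ∀ b z, f b (π z) = f (b + 1) z)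
    (S : Finset (Fin (2 ^ m))) (u : Fin (2 ^ m) → ZMod 2) :
    ∫ z, klIntegrand (cubeAvg S (wordDensity f m z) u) (cubeAvg ∅ (wordDensity f m z) u)
        ∂(Measure.pi fun _ => μ) ≤
      ∑ i ∈ S, 2 * (1 - bhattacharyya (subchannel W m i)) := by
  have h2 : (2 ^ (2 ^ m) : ℝ) ≠ 0 := by positivity
  have hflat := integral_klIntegrand_cubeAvg_eq (m := m) hf hπ hπf S
  have hkl := integrable_klIntegrand_cubeAvg (m := m) hf hf0 hW S
  have hword := integrable_wordDensity (m := m) hf hf0 hW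
  have hsqrt : ∀ i u, Integrable (fun z =>
      √(cubeAvg (insert i (Finset.Iio i)) (wordDensity f m z) u *
        cubeAvg (insert i (Finset.Iio i)) (wordDensity f m z) (u + Pi.single i 1)))
      (Measure.pi fun _ => μ) := by
    intro i u
    set T := insert i (Finset.Iio i)
    refine ((integrable_cubeAvg_wordDensity hf hf0 hW T u).add
      (integrable_cubeAvg_wordDensity hf hf0 hW T (u + Pi.single i 1))).mono'
      ((measurable_cubeAvg_wordDensity hf T u).mul
        (measurable_cubeAvg_wordDensity hf T _)).sqrt.aestronglyMeasurable (.of_forall fun z => ?_)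
    have ha := cubeAvg_nonneg T (wordDensity_nonneg (m := m) hf0 z) u
    have hb := cubeAvg_nonneg T (wordDensity_nonneg (m := m) hf0 z) (u + Pi.single i 1)
    rw [Real.norm_of_nonneg (Real.sqrt_nonneg _), Pi.add_apply]
    refine Real.sqrt_le_iff.2 ⟨add_nonneg ha hb, ?_⟩
    nlinarith [mul_nonneg ha hb]
  have hdiff : ∀ i, Integrable (fun z => 2 * ∑ u, (wordDensity f m z u -
      √(cubeAvg (insert i (Finset.Iio i)) (wordDensity f m z) u *
        cubeAvg (insert i (Finset.Iio i)) (wordDensity f m z) (u + Pi.single i 1))))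
      (Measure.pi fun _ => μ) := fun i =>
    (integrable_finsetSum _ fun u _ => (hword u).sub (hsqrt i u)).const_mul 2
  -- Summed over all `u`, the corrections `q - p` cancel, and the weight `cubeAvg S` may be replaced
  -- by the word density because the logarithms depend only on `S`.
  have hpt : ∀ z, ∑ u, klIntegrand (cubeAvg S (wordDensity f m z) u)
      (cubeAvg ∅ (wordDensity f m z) u) ≤
      ∑ i ∈ S, 2 * ∑ u, (wordDensity f m z u -
        √(cubeAvg (insert i (Finset.Iio i)) (wordDensity f m z) u *
          cubeAvg (insert i (Finset.Iio i)) (wordDensity f m z) (u + Pi.single i 1))) := by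
    intro z
    have hg := wordDensity_nonneg (m := m) hf0 z
    refine le_trans (le_of_eq ?_) (sum_mul_log_cubeAvg_le_sum S hg)
    have hdep : DependsOnlyOn S (fun u => Real.log (cubeAvg S (wordDensity f m z) u) -
        Real.log (cubeAvg ∅ (wordDensity f m z) u)) := by
      intro u w
      simp only [dependsOnlyOn_cubeAvg (Finset.Subset.refl S) _ u w,
        dependsOnlyOn_cubeAvg (Finset.empty_subset S) _ u w]
    have h1 : ∀ u, klIntegrand (cubeAvg S (wordDensity f m z) u)
        (cubeAvg ∅ (wordDensity f m z) u) =
        cubeAvg S (wordDensity f m z) u * (Real.log (cubeAvg S (wordDensity f m z) u) -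
          Real.log (cubeAvg ∅ (wordDensity f m z) u)) + cubeAvg ∅ (wordDensity f m z) u -
          cubeAvg S (wordDensity f m z) u := by
      intro u
      refine klIntegrand_eq fun h0 => le_antisymm ?_ (cubeAvg_nonneg S hg u)
      simpa [h0] using cubeAvg_le_cubeAvg_empty S hg u u
    simp only [h1]
    rw [Finset.sum_sub_distrib, Finset.sum_add_distrib, sum_cubeAvg_mul S _ _ hdep, sum_cubeAvg,
      sum_cubeAvg, add_sub_cancel_right]
  have hZ : ∀ i, ∫ z, 2 * ∑ u, (wordDensity f m z u -
      √(cubeAvg (insert i (Finset.Iio i)) (wordDensity f m z) u *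
        cubeAvg (insert i (Finset.Iio i)) (wordDensity f m z) (u + Pi.single i 1)))
      ∂(Measure.pi fun _ => μ) =
      2 ^ (2 ^ m) * (2 * (1 - bhattacharyya (subchannel W m i))) := by
    intro i
    have hsub : ∀ u, Integrable (fun z => wordDensity f m z u -
        √(cubeAvg (insert i (Finset.Iio i)) (wordDensity f m z) u *
          cubeAvg (insert i (Finset.Iio i)) (wordDensity f m z) (u + Pi.single i 1)))
        (Measure.pi fun _ => μ) := fun u => (hword u).sub (hsqrt i u)
    rw [bhattacharyya_subchannel hf hf0 hW, integral_const_mul, integral_const_mul,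
      integral_finsetSum _ fun u _ => hsub u,
      integral_finsetSum _ fun u _ => hsqrt i u]
    simp only [integral_sub (hword _) (hsqrt i _), integral_wordDensity hf hf0 hW]
    rw [Finset.sum_sub_distrib, sum_cube_const, Fintype.card_fin]
    field_simp
  -- Integrate the pointwise bound; all `2 ^ N` integrals on the left agree by symmetry, so the sum
  -- gives the bound for each single `u`.
  have hint := integral_mono (integrable_finsetSum Finset.univ fun u _ => hkl u)
    (integrable_finsetSum S fun i _ => hdiff i) hpt
  rw [integral_finsetSum _ fun u _ => hkl u, integral_finsetSum _ fun i _ => hdiff i,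
    Finset.sum_congr rfl fun u _ => hflat u, sum_cube_const, Fintype.card_fin,
    Finset.sum_congr rfl fun i _ => hZ i, ← Finset.mul_sum] at hint
  rw [hflat u]
  exact le_of_mul_le_mul_left hint (by positivity)

/-- If the input word is uniform outside of `S`, conditionally on its coordinates in `S`, then the
information that the output reveals about a function of the coordinates in `S` is controlled by
the Bhattacharyya parameters of the subchannels with index in `S`. -/
lemma klDiv_map_prodMk_le {Ω γ : Type*} [MeasurableSpace Ω] [Fintype γ] [DecidableEq γ]
    [MeasurableSpace γ] [MeasurableSingletonClass γ] {P : Measure Ω} [IsProbabilityMeasure P]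
    (hBMS : IsBMS W) {U : Ω → Fin (2 ^ m) → ZMod 2} {Z : Ω → Fin (2 ^ m) → 𝓩}
    (hU : Measurable U) (hZ : Measurable Z)
    (h : HasCondDistrib Z U (combinedChannel W m) P) {S : Finset (Fin (2 ^ m))}
    (hS : DependsOnlyOn S fun u => (P.map U).real {u})
    (r : (Fin (2 ^ m) → ZMod 2) → γ) (hr : ∀ u w, r (S.piecewise u w) = r u) :
    InformationTheory.klDiv (P.map fun ω => (r (U ω), Z ω))
        ((P.map fun ω => r (U ω)).prod (P.map Z)) ≤
      ENNReal.ofReal (∑ i ∈ S, 2 * (1 - bhattacharyya (subchannel W m i))) := by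
  have hM : IsMarkovKernel W := hBMS.markov
  obtain ⟨μ, π, f, hμ, hπ, hf, hf0, hπf, hW⟩ := hBMS.exists_density
  set ν : Measure (Fin (2 ^ m) → 𝓩) := Measure.pi fun _ => μ
  set a : (Fin (2 ^ m) → ZMod 2) → ℝ := fun u => (P.map U).real {u} with ha_def
  have hrU : Measurable fun ω => r (U ω) := (measurable_of_finite r).comp hU
  have hPU : IsProbabilityMeasure (P.map U) := Measure.isProbabilityMeasure_map hU.aemeasurable
  have hPZ : IsProbabilityMeasure (P.map Z) := Measure.isProbabilityMeasure_map hZ.aemeasurable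
  have hPr : IsProbabilityMeasure (P.map fun ω => r (U ω)) :=
    Measure.isProbabilityMeasure_map hrU.aemeasurable
  have hPJ : IsProbabilityMeasure (P.map fun ω => (r (U ω), Z ω)) :=
    Measure.isProbabilityMeasure_map (hrU.prodMk hZ).aemeasurable
  have ha : ∀ u, 0 ≤ a u := fun u => measureReal_nonneg
  have ha1 : ∑ u, a u = 1 := by
    rw [ha_def, sum_measureReal_singleton]
    simp
  have hg := measurable_wordDensity (m := m) hf
  have hg0 := wordDensity_nonneg (m := m) hf0
  have hκ := combinedChannel_eq_withDensity (m := m) hf hf0 hW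
  set p : γ × (Fin (2 ^ m) → 𝓩) → ℝ := fun x =>
    ∑ u with r u = x.1, a u * wordDensity f m x.2 u with hp_def
  set q : γ × (Fin (2 ^ m) → 𝓩) → ℝ := fun x =>
    (∑ u with r u = x.1, a u) * ∑ u, a u * wordDensity f m x.2 u with hq_def
  have hsum_meas : Measurable fun z => ∑ u, a u * wordDensity f m z u :=
    Finset.measurable_sum _ fun u _ => (hg u).const_mul _
  have hp : Measurable p := by
    refine measurable_from_prod_countable_right fun c => ?_
    simp only [hp_def]
    exact Finset.measurable_sum _ fun u _ => (hg u).const_mul _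
  have hq : Measurable q := by
    refine measurable_from_prod_countable_right fun c => ?_
    simp only [hq_def]
    exact hsum_meas.const_mul _
  have hp0 : ∀ x, 0 ≤ p x := fun x =>
    Finset.sum_nonneg fun u _ => mul_nonneg (ha u) (hg0 _ u)
  have hq0 : ∀ x, 0 ≤ q x := fun x => mul_nonneg (Finset.sum_nonneg fun u _ => ha u)
    (Finset.sum_nonneg fun u _ => mul_nonneg (ha u) (hg0 _ u))
  have hjoint : P.map (fun ω => (r (U ω), Z ω)) =
      (Measure.count.prod ν).withDensity fun x => ENNReal.ofReal (p x) :=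
    map_prodMk_eq_withDensity_of_hasCondDistrib hU hZ h hg hg0 hκ r
  have hprod : (P.map fun ω => r (U ω)).prod (P.map Z) =
      (Measure.count.prod ν).withDensity fun x => ENNReal.ofReal (q x) := by
    rw [eq_withDensity_count (P.map fun ω => r (U ω)),
      map_eq_withDensity_of_hasCondDistrib hU hZ h hg hg0 hκ,
      prod_withDensity (measurable_of_finite _) hsum_meas.ennreal_ofReal]
    congr 1
    ext x
    rw [← ENNReal.ofReal_mul measureReal_nonneg, measureReal_map_singleton hU r]
  have hfin1 : IsFiniteMeasure ((Measure.count.prod ν).withDensity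
      fun x => ENNReal.ofReal (p x)) := by
    rw [← hjoint]; infer_instance
  have hfin2 : IsFiniteMeasure ((Measure.count.prod ν).withDensity
      fun x => ENNReal.ofReal (q x)) := by
    rw [← hprod]; infer_instance
  have hmkl : Measurable fun x => ENNReal.ofReal (klIntegrand (p x) (q x)) :=
    (measurable_klIntegrand hp hq).ennreal_ofReal
  have hmkl' : ∀ c, Measurable fun z => ENNReal.ofReal (klIntegrand (p (c, z)) (q (c, z))) :=
    fun c => hmkl.comp measurable_prodMk_left
  -- Both the law of `U` and the message depend only on the coordinates in `S`, so the word density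
  -- may be averaged over the others.
  have hreplace : ∀ z c, ∑ u with r u = c, a u * wordDensity f m z u =
      ∑ u with r u = c, a u * cubeAvg S (wordDensity f m z) u := by
    intro z c
    have hdep : DependsOnlyOn S fun u => if r u = c then a u else 0 := by
      intro u w
      dsimp only
      rw [hr u w, hS u w]
    have := sum_cubeAvg_mul S (wordDensity f m z) _ hdep
    rw [Finset.sum_filter, Finset.sum_filter]
    simpa [mul_comm] using this.symm
  have hreplace' : ∀ z, ∑ u, a u * wordDensity f m z u =
      ∑ u, a u * cubeAvg S (wordDensity f m z) u := by
    intro z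
    rw [← Finset.sum_fiberwise Finset.univ r, ← Finset.sum_fiberwise Finset.univ r]
    exact Finset.sum_congr rfl fun c _ => hreplace z c
  have hpt : ∀ z, ∑ c, klIntegrand (p (c, z)) (q (c, z)) ≤
      ∑ u, a u * klIntegrand (cubeAvg S (wordDensity f m z) u)
        (cubeAvg ∅ (wordDensity f m z) u) := by
    intro z
    have hconst : ∀ u, cubeAvg ∅ (wordDensity f m z) u = cubeAvg ∅ (wordDensity f m z) 0 :=
      fun u => by rw [cubeAvg_empty, cubeAvg_empty]
    simp only [hp_def, hq_def, hreplace, hreplace', hconst]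
    refine sum_klIntegrand_le r ha ha1 (cubeAvg_nonneg S (hg0 z)) (cubeAvg_nonneg ∅ (hg0 z) 0)
      fun u h0 => le_antisymm ?_ (cubeAvg_nonneg S (hg0 z) u)
    simpa [h0] using cubeAvg_le_cubeAvg_empty S (hg0 z) u 0
  have hkl := integrable_klIntegrand_cubeAvg (m := m) hf hf0 hW S
  calc _ = ∫⁻ x, ENNReal.ofReal (klIntegrand (p x) (q x)) ∂(Measure.count.prod ν) := by
        rw [hjoint, hprod, klDiv_withDensity_ofReal hp hq hp0 hq0 fun x =>
          sum_fiber_mul_eq_zero r ha (hg0 x.2) x.1]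
    _ = ∫⁻ z, ENNReal.ofReal (∑ c, klIntegrand (p (c, z)) (q (c, z))) ∂ν := by
        rw [lintegral_prod _ hmkl.aemeasurable, lintegral_count, tsum_fintype,
          ← lintegral_finsetSum _ fun c _ => hmkl' c]
        refine lintegral_congr fun z => ?_
        rw [ENNReal.ofReal_sum_of_nonneg fun c _ => klIntegrand_nonneg (hp0 _) (hq0 _)]
    _ ≤ ∫⁻ z, ENNReal.ofReal (∑ u, a u * klIntegrand (cubeAvg S (wordDensity f m z) u)
          (cubeAvg ∅ (wordDensity f m z) u)) ∂ν :=
        lintegral_mono fun z => ENNReal.ofReal_le_ofReal (hpt z)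
    _ = ENNReal.ofReal (∫ z, ∑ u, a u * klIntegrand (cubeAvg S (wordDensity f m z) u)
          (cubeAvg ∅ (wordDensity f m z) u) ∂ν) := by
        refine (ofReal_integral_eq_lintegral_ofReal
          (integrable_finsetSum _ fun u _ => (hkl u).const_mul _) (.of_forall fun z => ?_)).symm
        exact Finset.sum_nonneg fun u _ => mul_nonneg (ha u)
          (klIntegrand_nonneg (cubeAvg_nonneg S (hg0 z) u) (cubeAvg_nonneg ∅ (hg0 z) u))
    _ ≤ _ := by
        refine ENNReal.ofReal_le_ofReal ?_
        rw [integral_finsetSum _ fun u _ => (hkl u).const_mul _]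
        simp only [integral_const_mul]
        calc _ ≤ ∑ u, a u * ∑ i ∈ S, 2 * (1 - bhattacharyya (subchannel W m i)) :=
              Finset.sum_le_sum fun u _ => mul_le_mul_of_nonneg_left
                (integral_klIntegrand_cubeAvg_le hf hf0 hW hπ hπf S u) (ha u)
          _ = _ := by rw [← Finset.sum_mul, ha1, one_mul]

end Leakage

/-! ### The wiretap scheme and the final estimate. -/

section Scheme

variable {Ω 𝓩 : Type*} [MeasurableSpace Ω] [MeasurableSpace 𝓩] {P : Measure Ω}
  {W : Kernel (ZMod 2) 𝓩} {m : ℕ} {A B C D : Set (Fin (2 ^ m))}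
  {M : Ω → A → ZMod 2} {R : Ω → B → ZMod 2} {F : Ω → C → ZMod 2} {R' : Ω → D → ZMod 2}
  {U : Ω → Fin (2 ^ m) → ZMod 2} {Z : Ω → Fin (2 ^ m) → 𝓩}

lemma IsWiretapScheme.measurable_U (h : IsWiretapScheme P W A B C D M R F R' U Z)
    (hcover : ∀ i, i ∈ A ∨ i ∈ B ∨ i ∈ C ∨ i ∈ D) : Measurable U := by
  refine measurable_pi_iff.2 fun i => ?_
  rcases hcover i with hi | hi | hi | hi
  · simpa only [← h.assign_A _ ⟨i, hi⟩] using measurable_pi_iff.1 h.measurable_M ⟨i, hi⟩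
  · simpa only [← h.assign_B _ ⟨i, hi⟩] using measurable_pi_iff.1 h.measurable_R ⟨i, hi⟩
  · simpa only [← h.assign_C _ ⟨i, hi⟩] using measurable_pi_iff.1 h.measurable_F ⟨i, hi⟩
  · simpa only [← h.assign_D _ ⟨i, hi⟩] using measurable_pi_iff.1 h.measurable_R' ⟨i, hi⟩

/-- The law of the assembled word is uniform in the coordinates that carry random bits. -/
lemma IsWiretapScheme.map_U_singleton (h : IsWiretapScheme P W A B C D M R F R' U Z)
    (hcover : ∀ i, i ∈ A ∨ i ∈ B ∨ i ∈ C ∨ i ∈ D) {u v : Fin (2 ^ m) → ZMod 2}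
    (hA : ∀ i ∈ A, u i = v i) (hC : ∀ i ∈ C, u i = v i) : P.map U {u} = P.map U {v} := by
  classical
  -- The event `U = u` splits into an event of `(M, F)` and an independent one of `(R, R')`, whose
  -- probability is the same for every `u` by uniformity.
  have hset : ∀ u : Fin (2 ^ m) → ZMod 2, U ⁻¹' {u} =
      (fun ω => (M ω, F ω)) ⁻¹' {(fun i => u i.1, fun i => u i.1)} ∩
        (fun ω => (R ω, R' ω)) ⁻¹' {(fun i => u i.1, fun i => u i.1)} := by
    intro u
    ext ω
    simp only [Set.mem_preimage, Set.mem_singleton_iff, Set.mem_inter_iff, Prod.mk.injEq,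
      funext_iff, Subtype.forall, ← h.assign_A, ← h.assign_B, ← h.assign_C, ← h.assign_D]
    constructor
    · intro hu
      exact ⟨⟨fun i _ => hu i, fun i _ => hu i⟩, ⟨fun i _ => hu i, fun i _ => hu i⟩⟩
    · rintro ⟨⟨h1, h2⟩, h3, h4⟩ i
      rcases hcover i with hi | hi | hi | hi
      exacts [h1 i hi, h3 i hi, h2 i hi, h4 i hi]
  have hprob : ∀ u : Fin (2 ^ m) → ZMod 2, P.map U {u} =
      P ((fun ω => (M ω, F ω)) ⁻¹' {(fun i => u i.1, fun i => u i.1)}) *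
        (Fintype.card ((B → ZMod 2) × (D → ZMod 2)) : ℝ≥0∞)⁻¹ := by
    intro u
    rw [Measure.map_apply (h.measurable_U hcover) (measurableSet_singleton u), hset,
      h.random_indep.measure_inter_preimage_eq_mul _ _ (measurableSet_singleton _)
        (measurableSet_singleton _),
      ← Measure.map_apply (h.measurable_R.prodMk h.measurable_R') (measurableSet_singleton _),
      h.random_uniform.map_eq, uniformOn_univ, Measure.count_singleton, one_div]
  have hu : (fun i : A => u i) = fun i : A => v i := funext fun i => hA i i.2
  have hv : (fun i : C => u i) = fun i : C => v i := funext fun i => hC i i.2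
  rw [hprob, hprob, hu, hv]

end Scheme

/-- For large block lengths, the exponent `β` absorbs a constant factor. -/
lemma exists_forall_four_mul_rpow_le {β β' : ℝ} (hβ' : 0 < β') (hβ : β' < β) :
    ∃ N₀ : ℕ, ∀ x : ℝ, 1 ≤ x → (N₀ : ℝ) ≤ x →
      4 * (2 : ℝ) ^ (-(x ^ β)) ≤ (2 : ℝ) ^ (-(x ^ β')) := by
  have hd : 0 < β - β' := sub_pos.2 hβ
  -- This threshold gives `x^(β-β') ≥ 3`, hence `x^β ≥ 3 x^β' ≥ x^β' + 2`, and the 2 in the exponent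
  -- pays for the factor 4.
  refine ⟨⌈(3 : ℝ) ^ (1 / (β - β'))⌉₊, fun x hx hN => ?_⟩
  have h3 : (3 : ℝ) ≤ x ^ (β - β') := by
    have h1 : (3 : ℝ) ^ (1 / (β - β')) ≤ x := (Nat.le_ceil _).trans hN
    have h2 := Real.rpow_le_rpow (by positivity) h1 hd.le
    rwa [← Real.rpow_mul (by norm_num), one_div_mul_cancel hd.ne', Real.rpow_one] at h2
  have h1 : 1 ≤ x ^ β' := Real.one_le_rpow hx hβ'.le
  have hmul : x ^ β = x ^ β' * x ^ (β - β') := by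
    rw [← Real.rpow_add (by linarith), add_sub_cancel]
  have hdiff : 2 + -(x ^ β) ≤ -(x ^ β') := by
    rw [hmul]
    nlinarith
  calc 4 * (2 : ℝ) ^ (-(x ^ β)) = (2 : ℝ) ^ (2 + -(x ^ β)) := by
        rw [Real.rpow_add (by norm_num)]
        norm_num
    _ ≤ _ := Real.rpow_le_rpow_of_exponent_le (by norm_num) hdiff

/-- The leakage of the wiretap scheme, in terms of the threshold that defines the poor set. -/
lemma IsWiretapScheme.mutualInfo_le {𝓨 𝓩 Ω : Type*} [MeasurableSpace 𝓨] [MeasurableSpace 𝓩]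
    [MeasurableSpace Ω] {V : Kernel (ZMod 2) 𝓨} {W : Kernel (ZMod 2) 𝓩} (hW : IsBMS W)
    {β : ℝ} {m : ℕ} {P : Measure Ω} [IsProbabilityMeasure P]
    {M : Ω → setA V W β m → ZMod 2} {R : Ω → setB V W β m → ZMod 2}
    {F : Ω → setC V W β m → ZMod 2} {R' : Ω → setD V W β m → ZMod 2}
    {U : Ω → Fin (2 ^ m) → ZMod 2} {Z : Ω → Fin (2 ^ m) → 𝓩}
    (h : IsWiretapScheme P W (setA V W β m) (setB V W β m) (setC V W β m) (setD V W β m)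
      M R F R' U Z) :
    mutualInfo P M Z ≤
      ENNReal.ofReal ((2 : ℝ) ^ m * (4 * (2 : ℝ) ^ (-(((2 : ℝ) ^ m) ^ β)))) := by
  classical
  set δ : ℝ := (2 : ℝ) ^ (-(((2 : ℝ) ^ m) ^ β))
  have hδ0 : 0 ≤ δ := by positivity
  have hcover : ∀ i, i ∈ setA V W β m ∨ i ∈ setB V W β m ∨ i ∈ setC V W β m ∨
      i ∈ setD V W β m := by
    intro i
    simp only [setA, setB, setC, setD, Set.mem_inter_iff, Set.mem_compl_iff]
    tauto
  set S : Finset (Fin (2 ^ m)) := (poorSet W β m).toFinset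
  have hmemA : ∀ i ∈ setA V W β m, i ∈ S := fun i hi => Set.mem_toFinset.2 hi.2
  have hmemC : ∀ i ∈ setC V W β m, i ∈ S := fun i hi => Set.mem_toFinset.2 hi.2
  have hdep : DependsOnlyOn S fun u => (P.map U).real {u} := by
    intro u w
    dsimp only
    rw [measureReal_def, measureReal_def, h.map_U_singleton hcover (v := u)]
    · exact fun i hi => Finset.piecewise_eq_of_mem _ _ _ (hmemA i hi)
    · exact fun i hi => Finset.piecewise_eq_of_mem _ _ _ (hmemC i hi)
  have hM : M = fun ω => (fun (u : Fin (2 ^ m) → ZMod 2) (i : setA V W β m) => u i) (U ω) := by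
    ext ω i
    exact (h.assign_A ω i).symm
  have hkl := klDiv_map_prodMk_le hW (h.measurable_U hcover) h.measurable_Z h.channel hdep
    (fun (u : Fin (2 ^ m) → ZMod 2) (i : setA V W β m) => u i)
    (fun u w => funext fun i => Finset.piecewise_eq_of_mem _ _ _ (hmemA i i.2))
  -- Passing from nats to bits divides by `log 2 > 1/2`, which turns `2 * δ` into at most `4 * δ`.
  have hlog : (1 : ℝ) / 2 < Real.log 2 := by linarith [Real.log_two_gt_d9]
  have hsum : ∑ i ∈ S, 2 * (1 - bhattacharyya (subchannel W m i)) ≤ 2 ^ m * (2 * δ) := by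
    calc ∑ i ∈ S, 2 * (1 - bhattacharyya (subchannel W m i)) ≤ ∑ _i ∈ S, 2 * δ := by
          refine Finset.sum_le_sum fun i hi => ?_
          have : 1 - δ ≤ bhattacharyya (subchannel W m i) := (Set.mem_toFinset.1 hi : i ∈ poorSet W β m)
          linarith
      _ = S.card * (2 * δ) := by rw [Finset.sum_const, nsmul_eq_mul]
      _ ≤ 2 ^ m * (2 * δ) := by
          refine mul_le_mul_of_nonneg_right ?_ (by positivity)
          have := S.card_le_univ
          rw [Fintype.card_fin] at this
          exact_mod_cast this
  rw [mutualInfo, hM]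
  refine (ENNReal.div_le_div_right (hkl.trans (ENNReal.ofReal_le_ofReal hsum)) _).trans ?_
  rw [← ENNReal.ofReal_div_of_pos (by linarith)]
  refine ENNReal.ofReal_le_ofReal ?_
  rw [div_le_iff₀ (by linarith)]
  have : 0 ≤ 2 ^ m * δ := by positivity
  nlinarith

end PolarWiretap

end

theorem mainTheorem5 (β β' : ℝ) (hβ' : 0 < β') (hβ'β : β' < β) (hβ : β < 1 / 2) :
    ∃ N₀ : ℕ, ∀ m : ℕ, 1 ≤ m → N₀ ≤ 2 ^ m →
      ∀ (𝓨 : Type*) (𝓩 : Type*) [MeasurableSpace 𝓨] [MeasurableSpace 𝓩]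
        (V : ProbabilityTheory.Kernel (ZMod 2) 𝓨) (W : ProbabilityTheory.Kernel (ZMod 2) 𝓩),
        PolarWiretap.IsBMS V → PolarWiretap.IsBMS W → PolarWiretap.IsDegraded W V →
      ∀ (Ω : Type*) [MeasurableSpace Ω] (P : MeasureTheory.Measure Ω)
        [MeasureTheory.IsProbabilityMeasure P]
        (M : Ω → PolarWiretap.setA V W β m → ZMod 2)
        (R : Ω → PolarWiretap.setB V W β m → ZMod 2)
        (F : Ω → PolarWiretap.setC V W β m → ZMod 2)
        (R' : Ω → PolarWiretap.setD V W β m → ZMod 2)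
        (U : Ω → Fin (2 ^ m) → ZMod 2) (Z : Ω → Fin (2 ^ m) → 𝓩),
        PolarWiretap.IsWiretapScheme P W (PolarWiretap.setA V W β m) (PolarWiretap.setB V W β m)
          (PolarWiretap.setC V W β m) (PolarWiretap.setD V W β m) M R F R' U Z →
        PolarWiretap.mutualInfo P M Z ≤
          ENNReal.ofReal ((2 : ℝ) ^ m * (2 : ℝ) ^ (-(((2 : ℝ) ^ m) ^ β'))) := by
  obtain ⟨N₀, hN₀⟩ := PolarWiretap.exists_forall_four_mul_rpow_le hβ' hβ'β
  refine ⟨N₀, ?_⟩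
  intro m _ hm 𝓨 𝓩 _ _ V W _ hW _ Ω _ P _ M R F R' U Z h
  refine (h.mutualInfo_le hW).trans (ENNReal.ofReal_le_ofReal ?_)
  refine mul_le_mul_of_nonneg_left (hN₀ _ (one_le_pow₀ one_le_two) ?_) (by positivity)
  exact_mod_cast hm
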